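/- Let $F$ be a finite field and write $G_m=GL_m(F)$. Let $n,r$ be integers with $1\le r<2n$, let $\rho_1,\rho_2$ be finite-dimensional complex representations of $G_r$ and $G_{2n-r}$, and let $\psi_0:F\to\mathbb C^\times$ be a non-trivial additive character. Conventions. For a subgroup $H$ of a finite group $G$ and a complex representation $(\sigma,W)$ of $H$, $\mathrm{Ind}_H^G(\sigma)$ is the space of functions $f:G\to W$ with $f(hg)=\sigma(h)f(g)$ for $h\in H$, $g\in G$, on which $G$ acts by right translation. For a representation $(\pi,V)$ of $G$, a subgroup $U$ and a character $\theta$ of $U$, $\pi_{U,\theta}$ is the quotient $V/\langle \pi(u)v-\theta(u)v : u\in U, v\in V\rangle$, with the induced action of $\{g\in G: gug^{-1}\in U,\ \theta(gug^{-1})=\theta(u)\ \text{for all } u\in U\}$. Parabolic subgroups $P_{a,b}$, $P_{a,b,c}$ are the standard block upper triangular ones (blocks of size $0$ are omitted), and for $H\le G_n$ let $\Delta H=\{\begin{pmatrix} g&0\\0&g\end{pmatrix}: g\in H\}\le G_{2n}$. Let $\pi=\mathrm{Ind}_{P_{r,2n-r}}^{G_{2n}}(\rho_1\otimes\rho_2)$,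 where $\rho_1\otimes\rho_2$ is a representation of $P_{r,2n-r}$ through its block-diagonal part, that is, $\begin{pmatrix} g_1&x\\0&g_2\end{pmatrix}$ acts by $\rho_1(g_1)\otimes\rho_2(g_2)$. Let $N=\{\begin{pmatrix} I_n&x\\0&I_n\end{pmatrix}: x\in M_n(F)\}$ and $\psi\begin{pmatrix} I_n&x\\0&I_n\end{pmatrix}=\psi_0(\mathrm{tr}\,x)$; the group $\Delta G_n$ normalizes $(N,\psi)$, so it acts on $\pi_{N,\psi}$. For $\max\{0,r-n\}\le k\le\lfloor r/2\rfloor$ let $$N(k,1)=\left\{\begin{pmatrix} I_k&x&y\\0&I_k&0\\0&0&I_{r-2k}\end{pmatrix}\right\}\le G_r,\qquad N(k,2)=\left\{\begin{pmatrix} I_{r-2k}&0&w\\0&I_{n-r+k}&z\\0&0&I_{n-r+k}\end{pmatrix}\right\}\le G_{2n-r},$$ where $x,y,w,z$ range over all matrices over $F$ of the appropriate sizes, with characters $\psi_{k,1}$ and $\psi_{k,2}$ sending these elements to $\psi_0(\mathrm{tr}\,x)$ and $\psi_0(\mathrm{tr}\,z)$ respectively. Let $\tau_k$ be the representation of $\Delta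 P_{k,r-2k,n-r+k}$ on $(\rho_1)_{N(k,1),\psi_{k,1}}\otimes(\rho_2)_{N(k,2),\psi_{k,2}}$ given, for $Z=\begin{pmatrix} a&d&e\\0&b&f\\0&0&c\end{pmatrix}\in P_{k,r-2k,n-r+k}$ (diagonal blocks $a,b,c$ of sizes $k,r-2k,n-r+k$), by $$\tau_k\begin{pmatrix} Z&0\\0&Z\end{pmatrix}=(\rho_1)_{N(k,1),\psi_{k,1}}\begin{pmatrix} a&0&0\\0&a&d\\0&0&b\end{pmatrix}\otimes(\rho_2)_{N(k,2),\psi_{k,2}}\begin{pmatrix} b&f&0\\0&c&0\\0&0&c\end{pmatrix}.$$ Then there is an isomorphism of representations of $\Delta G_n$ $$\pi_{N,\psi}\;\cong\;\bigoplus_{\max\{0,r-n\}\le k\le\lfloor r/2\rfloor}\mathrm{Ind}_{\Delta P_{k,r-2k,n-r+k}}^{\Delta G_n}(\tau_k).$$ -/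

import Mathlib

open Matrix
set_option linter.unusedSectionVars false
set_option linter.unusedSimpArgs false

noncomputable section

namespace TwistedJacquet

/-! ### Twisted Jacquet modules -/

section Jacquet

variable {G : Type*} [Group G] {V : Type*} [AddCommGroup V] [Module ℂ V]

/-- `N_G(U, θ) = {g | g u g⁻¹ ∈ U and θ (g u g⁻¹) = θ u for all u ∈ U}`. -/
def twistNormalizer (U : Subgroup G) (θ : U →* ℂ) : Submonoid G where
  carrier := {g | ∀ u : U, ∃ h : g * u * g⁻¹ ∈ U, θ ⟨g * u * g⁻¹, h⟩ = θ u}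
  one_mem' u := ⟨by simp, by simp⟩
  mul_mem' {g g'} hg hg' u := by
    obtain ⟨h', e'⟩ := hg' u
    obtain ⟨h, e⟩ := hg ⟨_, h'⟩
    have key : g * g' * u * (g * g')⁻¹ = g * (g' * u * g'⁻¹) * g⁻¹ := by group
    refine ⟨key ▸ h, ?_⟩
    rw [← e', ← e]
    congr 1
    exact Subtype.ext key

/-- `V(U, θ)`, the span of all `π(u) v - θ(u) v`. -/
def twistSpan (π : Representation ℂ G V) (U : Subgroup G) (θ : U →* ℂ) : Submodule ℂ V :=
  Submodule.span ℂ {w | ∃ (u : U) (v : V), w = π u v - θ u • v}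

/-- The twisted Jacquet module `π_{U,θ}`: the action of `N_G(U, θ)` on `V / V(U, θ)`. -/
def jacquet (π : Representation ℂ G V) (U : Subgroup G) (θ : U →* ℂ) :
    Representation ℂ (twistNormalizer U θ) (V ⧸ twistSpan π U θ) :=
  Representation.quotient (π.comp (twistNormalizer U θ).subtype) (twistSpan π U θ) <| by
    rintro ⟨g, hg⟩
    refine Submodule.span_le.2 ?_
    rintro _ ⟨u, v, rfl⟩
    obtain ⟨h, e⟩ := hg u
    refine Submodule.subset_span ⟨⟨_, h⟩, π g v, ?_⟩
    rw [e]
    simp [← Module.End.mul_apply, ← map_mul]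

end Jacquet

/-! ### Block matrices -/

section Blocks

variable {F : Type*} [Field F]

/-- The division of `{0, …, m-1}` into consecutive blocks of sizes `a, b`. -/
def e2 {a b m : ℕ} (h : a + b = m) : Fin a ⊕ Fin b ≃ Fin m :=
  finSumFinEquiv.trans (finCongr h)

/-- The division of `{0, …, m-1}` into consecutive blocks of sizes `a, b, c`. -/
def e3 {a b c m : ℕ} (h : a + b + c = m) : (Fin a ⊕ Fin b) ⊕ Fin c ≃ Fin m :=
  (Equiv.sumCongr finSumFinEquiv (Equiv.refl (Fin c))).trans (e2 h)

/-- The `m × m` matrix with blocks `A B; C D`. -/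
def mat2 {a b m : ℕ} (h : a + b = m)
    (A : Matrix (Fin a) (Fin a) F) (B : Matrix (Fin a) (Fin b) F)
    (C : Matrix (Fin b) (Fin a) F) (D : Matrix (Fin b) (Fin b) F) : Matrix (Fin m) (Fin m) F :=
  (fromBlocks A B C D).submatrix (e2 h).symm (e2 h).symm

/-- The `m × m` matrix with blocks `A₁₁ A₁₂ A₁₃; A₂₁ A₂₂ A₂₃; A₃₁ A₃₂ A₃₃`. -/
def mat3 {a b c m : ℕ} (h : a + b + c = m)
    (A₁₁ : Matrix (Fin a) (Fin a) F) (A₁₂ : Matrix (Fin a) (Fin b) F)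
    (A₁₃ : Matrix (Fin a) (Fin c) F)
    (A₂₁ : Matrix (Fin b) (Fin a) F) (A₂₂ : Matrix (Fin b) (Fin b) F)
    (A₂₃ : Matrix (Fin b) (Fin c) F)
    (A₃₁ : Matrix (Fin c) (Fin a) F) (A₃₂ : Matrix (Fin c) (Fin b) F)
    (A₃₃ : Matrix (Fin c) (Fin c) F) : Matrix (Fin m) (Fin m) F :=
  (fromBlocks (fromBlocks A₁₁ A₁₂ A₂₁ A₂₂) (fromRows A₁₃ A₂₃) (fromCols A₃₁ A₃₂) A₃₃).submatrix
    (e3 h).symm (e3 h).symm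

/-- The positions of the first block among two. -/
def p1 {a b m : ℕ} (h : a + b = m) (i : Fin a) : Fin m := e2 h (Sum.inl i)
/-- The positions of the second block among two. -/
def p2 {a b m : ℕ} (h : a + b = m) (i : Fin b) : Fin m := e2 h (Sum.inr i)
/-- The positions of the first block among three. -/
def q1 {a b c m : ℕ} (h : a + b + c = m) (i : Fin a) : Fin m := e3 h (Sum.inl (Sum.inl i))
/-- The positions of the second block among three. -/
def q2 {a b c m : ℕ} (h : a + b + c = m) (i : Fin b) : Fin m := e3 h (Sum.inl (Sum.inr i))
/-- The positions of the third block among three. -/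
def q3 {a b c m : ℕ} (h : a + b + c = m) (i : Fin c) : Fin m := e3 h (Sum.inr i)

theorem mat2_mul {a b m : ℕ} (h : a + b = m)
    (A A' : Matrix (Fin a) (Fin a) F) (B B' : Matrix (Fin a) (Fin b) F)
    (C C' : Matrix (Fin b) (Fin a) F) (D D' : Matrix (Fin b) (Fin b) F) :
    mat2 h A B C D * mat2 h A' B' C' D' =
      mat2 h (A * A' + B * C') (A * B' + B * D') (C * A' + D * C') (C * B' + D * D') := by
  simp [mat2, submatrix_mul_equiv, fromBlocks_multiply]

theorem mat2_one {a b m : ℕ} (h : a + b = m) : mat2 h 1 0 0 1 = (1 : Matrix _ _ F) := by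
  simp [mat2]

theorem mat3_mul {a b c m : ℕ} (h : a + b + c = m)
    (A₁₁ B₁₁ : Matrix (Fin a) (Fin a) F) (A₁₂ B₁₂ : Matrix (Fin a) (Fin b) F)
    (A₁₃ B₁₃ : Matrix (Fin a) (Fin c) F)
    (A₂₁ B₂₁ : Matrix (Fin b) (Fin a) F) (A₂₂ B₂₂ : Matrix (Fin b) (Fin b) F)
    (A₂₃ B₂₃ : Matrix (Fin b) (Fin c) F)
    (A₃₁ B₃₁ : Matrix (Fin c) (Fin a) F) (A₃₂ B₃₂ : Matrix (Fin c) (Fin b) F)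
    (A₃₃ B₃₃ : Matrix (Fin c) (Fin c) F) :
    mat3 h A₁₁ A₁₂ A₁₃ A₂₁ A₂₂ A₂₃ A₃₁ A₃₂ A₃₃ * mat3 h B₁₁ B₁₂ B₁₃ B₂₁ B₂₂ B₂₃ B₃₁ B₃₂ B₃₃ =
      mat3 h (A₁₁ * B₁₁ + A₁₂ * B₂₁ + A₁₃ * B₃₁) (A₁₁ * B₁₂ + A₁₂ * B₂₂ + A₁₃ * B₃₂)
        (A₁₁ * B₁₃ + A₁₂ * B₂₃ + A₁₃ * B₃₃)
        (A₂₁ * B₁₁ + A₂₂ * B₂₁ + A₂₃ * B₃₁) (A₂₁ * B₁₂ + A₂₂ * B₂₂ + A₂₃ * B₃₂)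
        (A₂₁ * B₁₃ + A₂₂ * B₂₃ + A₂₃ * B₃₃)
        (A₃₁ * B₁₁ + A₃₂ * B₂₁ + A₃₃ * B₃₁) (A₃₁ * B₁₂ + A₃₂ * B₂₂ + A₃₃ * B₃₂)
        (A₃₁ * B₁₃ + A₃₂ * B₂₃ + A₃₃ * B₃₃) := by
  rw [mat3, mat3, submatrix_mul_equiv, mat3]
  congr 1
  ext ((i | i) | i) ((j | j) | j) <;>
    simp [Matrix.mul_apply, Fintype.sum_sum_type]

theorem mat3_one {a b c m : ℕ} (h : a + b + c = m) :
    mat3 h 1 0 0 0 1 0 0 0 1 = (1 : Matrix _ _ F) := by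
  simp [mat3]

theorem eq_mat2 {a b m : ℕ} (h : a + b = m) (M : Matrix (Fin m) (Fin m) F) :
    M = mat2 h (M.submatrix (p1 h) (p1 h)) (M.submatrix (p1 h) (p2 h))
      (M.submatrix (p2 h) (p1 h)) (M.submatrix (p2 h) (p2 h)) := by
  ext i j
  obtain ⟨i, rfl⟩ := (e2 h).surjective i
  obtain ⟨j, rfl⟩ := (e2 h).surjective j
  rcases i with i | i <;> rcases j with j | j <;> simp [mat2, p1, p2]

theorem eq_mat3 {a b c m : ℕ} (h : a + b + c = m) (M : Matrix (Fin m) (Fin m) F) :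
    M = mat3 h
      (M.submatrix (q1 h) (q1 h)) (M.submatrix (q1 h) (q2 h)) (M.submatrix (q1 h) (q3 h))
      (M.submatrix (q2 h) (q1 h)) (M.submatrix (q2 h) (q2 h)) (M.submatrix (q2 h) (q3 h))
      (M.submatrix (q3 h) (q1 h)) (M.submatrix (q3 h) (q2 h)) (M.submatrix (q3 h) (q3 h)) := by
  ext i j
  obtain ⟨i, rfl⟩ := (e3 h).surjective i
  obtain ⟨j, rfl⟩ := (e3 h).surjective j
  rcases i with (i | i) | i <;> rcases j with (j | j) | j <;> simp [mat3, q1, q2, q3]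

section
variable {a b m : ℕ} (h : a + b = m)
    (A : Matrix (Fin a) (Fin a) F) (B : Matrix (Fin a) (Fin b) F)
    (C : Matrix (Fin b) (Fin a) F) (D : Matrix (Fin b) (Fin b) F)

theorem mat2_11 : (mat2 h A B C D).submatrix (p1 h) (p1 h) = A := by
  ext; simp [mat2, p1]
theorem mat2_12 : (mat2 h A B C D).submatrix (p1 h) (p2 h) = B := by
  ext; simp [mat2, p1, p2]
theorem mat2_21 : (mat2 h A B C D).submatrix (p2 h) (p1 h) = C := by
  ext; simp [mat2, p1, p2]
theorem mat2_22 : (mat2 h A B C D).submatrix (p2 h) (p2 h) = D := by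
  ext; simp [mat2, p2]
end

section
variable {a b c m : ℕ} (h : a + b + c = m)
    (A₁₁ : Matrix (Fin a) (Fin a) F) (A₁₂ : Matrix (Fin a) (Fin b) F)
    (A₁₃ : Matrix (Fin a) (Fin c) F)
    (A₂₁ : Matrix (Fin b) (Fin a) F) (A₂₂ : Matrix (Fin b) (Fin b) F)
    (A₂₃ : Matrix (Fin b) (Fin c) F)
    (A₃₁ : Matrix (Fin c) (Fin a) F) (A₃₂ : Matrix (Fin c) (Fin b) F)
    (A₃₃ : Matrix (Fin c) (Fin c) F)

theorem mat3_11 : (mat3 h A₁₁ A₁₂ A₁₃ A₂₁ A₂₂ A₂₃ A₃₁ A₃₂ A₃₃).submatrix (q1 h) (q1 h) = A₁₁ := by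
  ext; simp [mat3, q1]
theorem mat3_12 : (mat3 h A₁₁ A₁₂ A₁₃ A₂₁ A₂₂ A₂₃ A₃₁ A₃₂ A₃₃).submatrix (q1 h) (q2 h) = A₁₂ := by
  ext; simp [mat3, q1, q2]
theorem mat3_22 : (mat3 h A₁₁ A₁₂ A₁₃ A₂₁ A₂₂ A₂₃ A₃₁ A₃₂ A₃₃).submatrix (q2 h) (q2 h) = A₂₂ := by
  ext; simp [mat3, q2]
theorem mat3_23 : (mat3 h A₁₁ A₁₂ A₁₃ A₂₁ A₂₂ A₂₃ A₃₁ A₃₂ A₃₃).submatrix (q2 h) (q3 h) = A₂₃ := by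
  ext; simp [mat3, q2, q3]
theorem mat3_33 : (mat3 h A₁₁ A₁₂ A₁₃ A₂₁ A₂₂ A₂₃ A₃₁ A₃₂ A₃₃).submatrix (q3 h) (q3 h) = A₃₃ := by
  ext; simp [mat3, q3]
end

/-! ### Parabolic subgroups -/

/-- The invertible matrices that are block upper triangular for the block labelling `β`. -/
def blockUpper {m : ℕ} (β : Fin m → ℕ) : Subgroup (GL (Fin m) F) where
  carrier := {g | BlockTriangular g.1 β}
  one_mem' := blockTriangular_one
  mul_mem' hg hg' := BlockTriangular.mul hg hg'
  inv_mem' {g} hg := by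
    have : Invertible g.1 := g.invertible
    have := blockTriangular_inv_of_blockTriangular (M := g.1) hg
    simpa [Matrix.coe_units_inv] using this

/-- The standard parabolic `P_{a,b}` of `GL_m`, `m = a + b`. -/
def parabolic2 (F : Type*) [Field F] {a b m : ℕ} (h : a + b = m) : Subgroup (GL (Fin m) F) :=
  blockUpper (Sum.elim (fun _ => 0) (fun _ => 1) ∘ (e2 h).symm)

/-- The standard parabolic `P_{a,b,c}` of `GL_m`, `m = a + b + c` (some of `a, b, c` may be `0`,
in which case the empty blocks are simply omitted). -/
def parabolic3 (F : Type*) [Field F] {a b c m : ℕ} (h : a + b + c = m) :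
    Subgroup (GL (Fin m) F) :=
  blockUpper (Sum.elim (Sum.elim (fun _ => 0) (fun _ => 1)) (fun _ => 2) ∘ (e3 h).symm)

theorem parabolic2_eq {a b m : ℕ} (h : a + b = m) (g : parabolic2 F h) :
    g.1.1 = mat2 h (g.1.1.submatrix (p1 h) (p1 h)) (g.1.1.submatrix (p1 h) (p2 h))
      0 (g.1.1.submatrix (p2 h) (p2 h)) := by
  have h21 : g.1.1.submatrix (p2 h) (p1 h) = 0 := by
    ext i j
    exact g.2 (by simp [p1, p2])
  conv_lhs => rw [eq_mat2 h g.1.1, h21]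

theorem parabolic3_eq {a b c m : ℕ} (h : a + b + c = m) (g : parabolic3 F h) :
    g.1.1 = mat3 h
      (g.1.1.submatrix (q1 h) (q1 h)) (g.1.1.submatrix (q1 h) (q2 h))
      (g.1.1.submatrix (q1 h) (q3 h))
      0 (g.1.1.submatrix (q2 h) (q2 h)) (g.1.1.submatrix (q2 h) (q3 h))
      0 0 (g.1.1.submatrix (q3 h) (q3 h)) := by
  have h21 : g.1.1.submatrix (q2 h) (q1 h) = 0 := by
    ext i j
    exact g.2 (by simp [q1, q2])
  have h31 : g.1.1.submatrix (q3 h) (q1 h) = 0 := by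
    ext i j
    exact g.2 (by simp [q1, q3])
  have h32 : g.1.1.submatrix (q3 h) (q2 h) = 0 := by
    ext i j
    exact g.2 (by simp [q2, q3])
  conv_lhs => rw [eq_mat3 h g.1.1, h21, h31, h32]

/-- The projection `(g₁ x; 0 g₂) ↦ g₁` of `P_{a,b}` to the first factor of its Levi subgroup. -/
def levi1 {a b m : ℕ} (h : a + b = m) : parabolic2 F h →* GL (Fin a) F :=
  MonoidHom.toHomUnits
    { toFun := fun g => g.1.1.submatrix (p1 h) (p1 h)
      map_one' := by
        change (1 : Matrix (Fin m) (Fin m) F).submatrix _ _ = 1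
        rw [← mat2_one h, mat2_11]
      map_mul' := fun g g' => by
        change (g.1.1 * g'.1.1).submatrix _ _ = _
        conv_lhs => rw [parabolic2_eq h g, parabolic2_eq h g', mat2_mul, mat2_11]
        simp }

/-- The projection `(g₁ x; 0 g₂) ↦ g₂` of `P_{a,b}` to the second factor of its Levi subgroup. -/
def levi2 {a b m : ℕ} (h : a + b = m) : parabolic2 F h →* GL (Fin b) F :=
  MonoidHom.toHomUnits
    { toFun := fun g => g.1.1.submatrix (p2 h) (p2 h)
      map_one' := by
        change (1 : Matrix (Fin m) (Fin m) F).submatrix _ _ = 1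
        rw [← mat2_one h, mat2_22]
      map_mul' := fun g g' => by
        change (g.1.1 * g'.1.1).submatrix _ _ = _
        conv_lhs => rw [parabolic2_eq h g, parabolic2_eq h g', mat2_mul, mat2_22]
        simp }

/-- The parabolically induced representation `Ind_{P_{a,b}}^{GL_m}(ρ₁ ⊗ ρ₂)`: functions `f` on
`GL_m` with `f (p g) = (ρ₁ ⊗ ρ₂)(p) f(g)` for `p ∈ P_{a,b}`, under right translation, where
`ρ₁ ⊗ ρ₂` is inflated from the Levi subgroup to `P_{a,b}`. -/
def parInd {a b m : ℕ} (h : a + b = m) {V₁ V₂ : Type*} [AddCommGroup V₁] [Module ℂ V₁]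
    [AddCommGroup V₂] [Module ℂ V₂]
    (ρ₁ : Representation ℂ (GL (Fin a) F) V₁) (ρ₂ : Representation ℂ (GL (Fin b) F) V₂) :=
  Representation.coind (parabolic2 F h).subtype
    (Representation.tprod (ρ₁.comp (levi1 h)) (ρ₂.comp (levi2 h)))

/-! ### The group `N` with its character and the diagonal subgroup -/

/-- `N = {(1 x; 0 1)}`, the unipotent radical of `P_{n,n}` in `GL_{2n}`. -/
def unipN (F : Type*) [Field F] (n : ℕ) : Subgroup (GL (Fin (2 * n)) F) where
  carrier := {g | ∃ x : Matrix (Fin n) (Fin n) F, g.1 = mat2 (two_mul n).symm 1 x 0 1}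
  one_mem' := ⟨0, (mat2_one _).symm⟩
  mul_mem' := by
    rintro g g' ⟨x, hx⟩ ⟨x', hx'⟩
    exact ⟨x' + x, by rw [Units.val_mul, hx, hx', mat2_mul]; simp⟩
  inv_mem' := by
    rintro g ⟨x, hx⟩
    refine ⟨-x, Units.inv_eq_of_mul_eq_one_right ?_⟩
    rw [hx, mat2_mul, ← mat2_one (two_mul n).symm]
    simp

/-- The character `(1 x; 0 1) ↦ ψ₀ (tr x)` of `N`. -/
def psi (ψ₀ : AddChar F ℂ) (n : ℕ) : unipN F n →* ℂ where
  toFun g := ψ₀ (trace (g.1.1.submatrix (p1 (two_mul n).symm) (p2 (two_mul n).symm)))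
  map_one' := by
    change ψ₀ (trace ((1 : Matrix _ _ F).submatrix _ _)) = 1
    rw [← mat2_one (two_mul n).symm, mat2_12]
    simp
  map_mul' := by
    rintro ⟨g, x, hx⟩ ⟨g', x', hx'⟩
    change ψ₀ (trace ((g.1 * g'.1).submatrix _ _)) = _
    rw [hx, hx', mat2_mul, mat2_12, mat2_12, mat2_12, ← AddChar.map_add_eq_mul]
    simp [add_comm]

/-- The diagonal embedding `g ↦ (g 0; 0 g)` of `GL_n` in `GL_{2n}`. -/
def diag (F : Type*) [Field F] (n : ℕ) : GL (Fin n) F →* GL (Fin (2 * n)) F :=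
  MonoidHom.toHomUnits
    { toFun := fun g => mat2 (two_mul n).symm g.1 0 0 g.1
      map_one' := mat2_one _
      map_mul' := fun g g' => by rw [mat2_mul]; simp }

theorem diag_injective (F : Type*) [Field F] (n : ℕ) : Function.Injective (diag F n) := by
  intro g g' hg
  have h : mat2 (two_mul n).symm g.1 0 0 g.1 = mat2 (two_mul n).symm g'.1 0 0 g'.1 :=
    congrArg Units.val hg
  refine Units.ext ?_
  have := congrArg (fun M => M.submatrix (p1 (two_mul n).symm) (p1 (two_mul n).symm)) h
  simpa only [mat2_11] using this

/-- `ΔH = {(g 0; 0 g) | g ∈ H}`. -/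
def Delta {n : ℕ} (H : Subgroup (GL (Fin n) F)) : Subgroup (GL (Fin (2 * n)) F) :=
  H.map (diag F n)

theorem Delta_mono {n : ℕ} {H K : Subgroup (GL (Fin n) F)} (hHK : H ≤ K) : Delta H ≤ Delta K :=
  Subgroup.map_mono hHK

/-- The isomorphism `ΔH ≃ H`, `(g 0; 0 g) ↦ g`. -/
def ofDelta {n : ℕ} (H : Subgroup (GL (Fin n) F)) : Delta H ≃* H :=
  (H.equivMapOfInjective (diag F n) (diag_injective F n)).symm

theorem Delta_le_twistNormalizer (ψ₀ : AddChar F ℂ) (n : ℕ) (g : Delta (F := F) (n := n) ⊤) :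
    g.1 ∈ twistNormalizer (unipN F n) (psi ψ₀ n) := by
  obtain ⟨_, g, -, rfl⟩ := g
  rintro ⟨u, x, hx⟩
  have e : (diag F n g * u * (diag F n g)⁻¹).1 =
      mat2 (two_mul n).symm 1 (g.1 * x * (g⁻¹).1) 0 1 := by
    rw [← map_inv]
    change mat2 _ g.1 0 0 g.1 * u.1 * mat2 _ (g⁻¹).1 0 0 (g⁻¹).1 = _
    rw [hx, mat2_mul, mat2_mul]
    simp
  refine ⟨⟨_, e⟩, ?_⟩
  change ψ₀ (trace ((diag F n g * u * (diag F n g)⁻¹).1.submatrix _ _)) =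
    ψ₀ (trace (u.1.submatrix _ _))
  rw [e, hx, mat2_12, mat2_12, trace_mul_comm, ← mul_assoc, Units.inv_mul, one_mul]

/-- `π_{N,ψ}` as a representation of `ΔGL_n`. -/
def jacquetN (ψ₀ : AddChar F ℂ) {n : ℕ} {V : Type*} [AddCommGroup V] [Module ℂ V]
    (π : Representation ℂ (GL (Fin (2 * n)) F) V) :
    Representation ℂ (Delta (F := F) (n := n) ⊤) (V ⧸ twistSpan π (unipN F n) (psi ψ₀ n)) :=
  (jacquet π (unipN F n) (psi ψ₀ n)).comp
    ((Delta ⊤).subtype.codRestrict _ (Delta_le_twistNormalizer ψ₀ n))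

/-! ### The groups `N(k,1)`, `N(k,2)` and their characters -/

/-- `{(1 x y; 0 1 0; 0 0 1)}` in `GL_m`, with blocks of sizes `a, a, b`. -/
def unip1 (F : Type*) [Field F] {a b m : ℕ} (h : a + a + b = m) : Subgroup (GL (Fin m) F) where
  carrier := {g | ∃ (x : Matrix (Fin a) (Fin a) F) (y : Matrix (Fin a) (Fin b) F),
    g.1 = mat3 h
      1 x y
      0 1 0
      0 0 1}
  one_mem' := ⟨0, 0, (mat3_one _).symm⟩
  mul_mem' := by
    rintro g g' ⟨x, y, hx⟩ ⟨x', y', hx'⟩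
    exact ⟨x' + x, y' + y, by rw [Units.val_mul, hx, hx', mat3_mul]; simp⟩
  inv_mem' := by
    rintro g ⟨x, y, hx⟩
    refine ⟨-x, -y, Units.inv_eq_of_mul_eq_one_right ?_⟩
    rw [hx, mat3_mul, ← mat3_one h]
    simp

/-- The character `(1 x y; 0 1 0; 0 0 1) ↦ ψ₀ (tr x)`. -/
def psi1 (ψ₀ : AddChar F ℂ) {a b m : ℕ} (h : a + a + b = m) : unip1 F h →* ℂ where
  toFun g := ψ₀ (trace (g.1.1.submatrix (q1 h) (q2 h)))
  map_one' := by
    change ψ₀ (trace ((1 : Matrix _ _ F).submatrix _ _)) = 1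
    rw [← mat3_one h, mat3_12]
    simp
  map_mul' := by
    rintro ⟨g, x, y, hx⟩ ⟨g', x', y', hx'⟩
    change ψ₀ (trace ((g.1 * g'.1).submatrix _ _)) = _
    rw [hx, hx', mat3_mul, mat3_12, mat3_12, mat3_12, ← AddChar.map_add_eq_mul]
    simp [add_comm]

/-- `{(1 0 w; 0 1 z; 0 0 1)}` in `GL_m`, with blocks of sizes `b, c, c`. -/
def unip2 (F : Type*) [Field F] {b c m : ℕ} (h : b + c + c = m) : Subgroup (GL (Fin m) F) where
  carrier := {g | ∃ (w : Matrix (Fin b) (Fin c) F) (z : Matrix (Fin c) (Fin c) F),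
    g.1 = mat3 h
      1 0 w
      0 1 z
      0 0 1}
  one_mem' := ⟨0, 0, (mat3_one _).symm⟩
  mul_mem' := by
    rintro g g' ⟨x, y, hx⟩ ⟨x', y', hx'⟩
    exact ⟨x' + x, y' + y, by rw [Units.val_mul, hx, hx', mat3_mul]; simp⟩
  inv_mem' := by
    rintro g ⟨x, y, hx⟩
    refine ⟨-x, -y, Units.inv_eq_of_mul_eq_one_right ?_⟩
    rw [hx, mat3_mul, ← mat3_one h]
    simp

/-- The character `(1 0 w; 0 1 z; 0 0 1) ↦ ψ₀ (tr z)`. -/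
def psi2 (ψ₀ : AddChar F ℂ) {b c m : ℕ} (h : b + c + c = m) : unip2 F h →* ℂ where
  toFun g := ψ₀ (trace (g.1.1.submatrix (q2 h) (q3 h)))
  map_one' := by
    change ψ₀ (trace ((1 : Matrix _ _ F).submatrix _ _)) = 1
    rw [← mat3_one h, mat3_23]
    simp
  map_mul' := by
    rintro ⟨g, x, y, hx⟩ ⟨g', x', y', hx'⟩
    change ψ₀ (trace ((g.1 * g'.1).submatrix _ _)) = _
    rw [hx, hx', mat3_mul, mat3_23, mat3_23, mat3_23, ← AddChar.map_add_eq_mul]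
    simp [add_comm]

/-! ### The representations `τ_k` -/

/-- The homomorphism `(a d e; 0 b f; 0 0 c) ↦ (a 0 0; 0 a d; 0 0 b)` on `P_{a,b,c}`. -/
def toFirst {a b c n r : ℕ} (h : a + b + c = n) (hr : a + a + b = r) :
    parabolic3 F h →* GL (Fin r) F :=
  MonoidHom.toHomUnits
    { toFun := fun g => mat3 hr
        (g.1.1.submatrix (q1 h) (q1 h)) 0 0
        0 (g.1.1.submatrix (q1 h) (q1 h)) (g.1.1.submatrix (q1 h) (q2 h))
        0 0 (g.1.1.submatrix (q2 h) (q2 h))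
      map_one' := by
        change mat3 hr ((1 : Matrix (Fin n) (Fin n) F).submatrix _ _) 0 0
          0 ((1 : Matrix (Fin n) (Fin n) F).submatrix _ _)
            ((1 : Matrix (Fin n) (Fin n) F).submatrix _ _)
          0 0 ((1 : Matrix (Fin n) (Fin n) F).submatrix _ _) = 1
        rw [← mat3_one h, mat3_11, mat3_12, mat3_22, mat3_one]
      map_mul' := fun g g' => by
        have e : (g * g').1.1 = g.1.1 * g'.1.1 := rfl
        rw [e]
        conv_lhs => rw [parabolic3_eq h g, parabolic3_eq h g', mat3_mul, mat3_11, mat3_12, mat3_22]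
        rw [mat3_mul]
        simp }

/-- The homomorphism `(a d e; 0 b f; 0 0 c) ↦ (b f 0; 0 c 0; 0 0 c)` on `P_{a,b,c}`. -/
def toSecond {a b c n s : ℕ} (h : a + b + c = n) (hs : b + c + c = s) :
    parabolic3 F h →* GL (Fin s) F :=
  MonoidHom.toHomUnits
    { toFun := fun g => mat3 hs
        (g.1.1.submatrix (q2 h) (q2 h)) (g.1.1.submatrix (q2 h) (q3 h)) 0
        0 (g.1.1.submatrix (q3 h) (q3 h)) 0
        0 0 (g.1.1.submatrix (q3 h) (q3 h))
      map_one' := by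
        change mat3 hs ((1 : Matrix (Fin n) (Fin n) F).submatrix _ _)
            ((1 : Matrix (Fin n) (Fin n) F).submatrix _ _) 0
          0 ((1 : Matrix (Fin n) (Fin n) F).submatrix _ _) 0
          0 0 ((1 : Matrix (Fin n) (Fin n) F).submatrix _ _) = 1
        rw [← mat3_one h, mat3_22, mat3_23, mat3_33, mat3_one]
      map_mul' := fun g g' => by
        have e : (g * g').1.1 = g.1.1 * g'.1.1 := rfl
        rw [e]
        conv_lhs => rw [parabolic3_eq h g, parabolic3_eq h g', mat3_mul, mat3_22, mat3_23, mat3_33]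
        rw [mat3_mul]
        simp }

theorem toFirst_mem (ψ₀ : AddChar F ℂ) {a b c n r : ℕ} (h : a + b + c = n) (hr : a + a + b = r)
    (g : parabolic3 F h) : toFirst h hr g ∈ twistNormalizer (unip1 F hr) (psi1 ψ₀ hr) := by
  rintro ⟨u, x, y, hx⟩
  obtain ⟨A, D, B, hA⟩ : ∃ A D B, (toFirst h hr g).1 = mat3 hr A 0 0 0 A D 0 0 B := ⟨_, _, _, rfl⟩
  obtain ⟨A', D', B', hA'⟩ : ∃ A D B, (toFirst h hr g⁻¹).1 = mat3 hr A 0 0 0 A D 0 0 B :=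
    ⟨_, _, _, rfl⟩
  have k1 : mat3 hr A 0 0 0 A D 0 0 B * mat3 hr A' 0 0 0 A' D' 0 0 B' = 1 := by
    rw [← hA, ← hA', ← Units.val_mul, ← map_mul]; simp
  have k2 : mat3 hr A' 0 0 0 A' D' 0 0 B' * mat3 hr A 0 0 0 A D 0 0 B = 1 := by
    rw [← hA, ← hA', ← Units.val_mul, ← map_mul]; simp
  rw [mat3_mul, ← mat3_one hr] at k1 k2
  have a1 := congrArg (fun M => M.submatrix (q1 hr) (q1 hr)) k1
  have a2 := congrArg (fun M => M.submatrix (q1 hr) (q1 hr)) k2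
  have a3 := congrArg (fun M => M.submatrix (q2 hr) (q3 hr)) k1
  have a4 := congrArg (fun M => M.submatrix (q3 hr) (q3 hr)) k1
  simp only [mat3_11, mat3_23, mat3_33, Matrix.zero_mul, Matrix.mul_zero, add_zero, zero_add] at a1 a2 a3 a4
  have e : (toFirst h hr g * u * (toFirst h hr g)⁻¹).1 =
      mat3 hr 1 (A * x * A') (A * x * D' + A * y * B') 0 1 0 0 0 1 := by
    rw [← map_inv, Units.val_mul, Units.val_mul, hA, hA']
    rw [hx, mat3_mul, mat3_mul]
    simp [a1, a3, a4]
  refine ⟨⟨_, _, e⟩, ?_⟩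
  change ψ₀ (trace ((toFirst h hr g * u * (toFirst h hr g)⁻¹).1.submatrix _ _)) =
    ψ₀ (trace (u.1.submatrix _ _))
  rw [e, hx, mat3_12, mat3_12, trace_mul_comm, ← mul_assoc, a2, one_mul]

theorem toSecond_mem (ψ₀ : AddChar F ℂ) {a b c n s : ℕ} (h : a + b + c = n) (hs : b + c + c = s)
    (g : parabolic3 F h) : toSecond h hs g ∈ twistNormalizer (unip2 F hs) (psi2 ψ₀ hs) := by
  rintro ⟨u, w, z, hx⟩
  obtain ⟨B, E, C, hA⟩ : ∃ B E C, (toSecond h hs g).1 = mat3 hs B E 0 0 C 0 0 0 C := ⟨_, _, _, rfl⟩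
  obtain ⟨B', E', C', hA'⟩ : ∃ B E C, (toSecond h hs g⁻¹).1 = mat3 hs B E 0 0 C 0 0 0 C :=
    ⟨_, _, _, rfl⟩
  have k1 : mat3 hs B E 0 0 C 0 0 0 C * mat3 hs B' E' 0 0 C' 0 0 0 C' = 1 := by
    rw [← hA, ← hA', ← Units.val_mul, ← map_mul]; simp
  have k2 : mat3 hs B' E' 0 0 C' 0 0 0 C' * mat3 hs B E 0 0 C 0 0 0 C = 1 := by
    rw [← hA, ← hA', ← Units.val_mul, ← map_mul]; simp
  rw [mat3_mul, ← mat3_one hs] at k1 k2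
  have a1 := congrArg (fun M => M.submatrix (q1 hs) (q1 hs)) k1
  have a2 := congrArg (fun M => M.submatrix (q3 hs) (q3 hs)) k2
  have a3 := congrArg (fun M => M.submatrix (q1 hs) (q2 hs)) k1
  have a4 := congrArg (fun M => M.submatrix (q3 hs) (q3 hs)) k1
  simp only [mat3_11, mat3_12, mat3_33, Matrix.zero_mul, Matrix.mul_zero, add_zero, zero_add] at a1 a2 a3 a4
  have e : (toSecond h hs g * u * (toSecond h hs g)⁻¹).1 =
      mat3 hs 1 0 ((B * w + E * z) * C') 0 1 (C * z * C') 0 0 1 := by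
    rw [← map_inv, Units.val_mul, Units.val_mul, hA, hA']
    rw [hx, mat3_mul, mat3_mul]
    simp [a1, a3, a4]
  refine ⟨⟨_, _, e⟩, ?_⟩
  change ψ₀ (trace ((toSecond h hs g * u * (toSecond h hs g)⁻¹).1.submatrix _ _)) =
    ψ₀ (trace (u.1.submatrix _ _))
  rw [e, hx, mat3_23, mat3_23, trace_mul_comm, ← mul_assoc, a2, one_mul]

/-- The representation of `ΔP_{a,b,c}` sending `diag(Z, Z)`, `Z = (a d e; 0 b f; 0 0 c)`, to
`(ρ₁)_{N₁,ψ₁}(a 0 0; 0 a d; 0 0 b) ⊗ (ρ₂)_{N₂,ψ₂}(b f 0; 0 c 0; 0 0 c)`. -/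
def tau (ψ₀ : AddChar F ℂ) {a b c n r s : ℕ} (h : a + b + c = n) (hr : a + a + b = r)
    (hs : b + c + c = s) {V₁ V₂ : Type*} [AddCommGroup V₁] [Module ℂ V₁]
    [AddCommGroup V₂] [Module ℂ V₂]
    (ρ₁ : Representation ℂ (GL (Fin r) F) V₁) (ρ₂ : Representation ℂ (GL (Fin s) F) V₂) :=
  Representation.tprod
    ((jacquet ρ₁ (unip1 F hr) (psi1 ψ₀ hr)).comp
      (((toFirst h hr).codRestrict _ (toFirst_mem ψ₀ h hr)).comp
        (ofDelta (parabolic3 F h)).toMonoidHom))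
    ((jacquet ρ₂ (unip2 F hs) (psi2 ψ₀ hs)).comp
      (((toSecond h hs).codRestrict _ (toSecond_mem ψ₀ h hs)).comp
        (ofDelta (parabolic3 F h)).toMonoidHom))

/-- `Ind_{ΔP_{a,b,c}}^{ΔGL_n}(τ)`: functions `f` on `ΔGL_n` with `f (p g) = τ(p) f(g)` for
`p ∈ ΔP_{a,b,c}`, under right translation. -/
def indTau (ψ₀ : AddChar F ℂ) {a b c n r s : ℕ} (h : a + b + c = n) (hr : a + a + b = r)
    (hs : b + c + c = s) {V₁ V₂ : Type*} [AddCommGroup V₁] [Module ℂ V₁]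
    [AddCommGroup V₂] [Module ℂ V₂]
    (ρ₁ : Representation ℂ (GL (Fin r) F) V₁) (ρ₂ : Representation ℂ (GL (Fin s) F) V₂) :=
  Representation.coind
    (Subgroup.inclusion (Delta_mono (le_top : parabolic3 F h ≤ ⊤))) (tau ψ₀ h hr hs ρ₁ ρ₂)

/-- The indices `max{0, r-n} ≤ k ≤ ⌊r/2⌋` (truncated subtraction does no harm inside `max 0`). -/
abbrev Index (n r : ℕ) : Type := {k : ℕ // max 0 (r - n) ≤ k ∧ k ≤ r / 2}

theorem Index.size_n {n r : ℕ} (k : Index n r) : k.1 + (r - 2 * k.1) + (n + k.1 - r) = n := by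
  have := k.2; omega
theorem Index.size_r {n r : ℕ} (k : Index n r) : k.1 + k.1 + (r - 2 * k.1) = r := by
  have := k.2; omega
theorem Index.size_s {n r : ℕ} (k : Index n r) :
    (r - 2 * k.1) + (n + k.1 - r) + (n + k.1 - r) = 2 * n - r := by
  have := k.2; omega

end Blocks

end TwistedJacquet

end

/-! Write `P` for `P_{r,2n-r}` and `ρ = ρ₁ ⊗ ρ₂`. Averaging over the finite group `N` identifies
`π_{N,ψ}` with the `(N,ψ)`-equivariant vectors of `π` (`twistAvg`, `twistSec`), that is, with the
functions `φ` satisfying `φ(pgu) = ψ(u) ρ(p) φ(g)` for `p ∈ P`, `u ∈ N`. Such a `φ` splits along the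
double cosets `P \ G_{2n} / ΔG_n N`. On the one through `w` it is determined by `h ↦ φ(wh)`, whose
values `a` must satisfy `ρ(p) a = ψ(u) a` whenever `p w = w u`; this Mackey argument is
`nonempty_equiv_directSum_coind`.

To find the cosets, split the last `s = 2n - r` rows of `g` as `(B₁ | B₂)` and put `f₁ v = v B₁`,
`f₂ v = v B₂`. If `f₂(ker f₁)` is not contained in `im f₁`, some `u = 1 + (rank one) ∈ N` has `ψ(u)
≠ 1` while `g u g⁻¹` lies in the unipotent radical of `P`, so `φ(g) = 0`
(`exists_unipotent_stabilizer`). Otherwise `f₂(ker f₁) ⊆ im f₁` is a flag in `F^n` of dimensions `c`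
and `b + c` with `b + 2c = s`. Moving it to the standard flag by `ΔG_n` and correcting by `N`
reaches a permutation matrix depending only on `k = c + r - n` (`exists_eq_mul_doubleCosetRep`). The
rank of `f₁` separates these cosets.

For such a `w`, the stabilizer in `ΔG_n` is `ΔP_{k,r-2k,n-r+k}`, with Levi components `toFirst` and
`toSecond`. The stabilizer in `N` projects onto `N(k,1) × N(k,2)`, and `ψ` becomes `ψ_{k,1} ψ_{k,2}`
(`levi_mem_unip`, `exists_of_unip`). Hence the admissible values form the space of `τ_k`, and `h ↦
φ(wh)` runs through the induced representation. -/

namespace TwistedJacquet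

/-! ### Averaging over a finite subgroup: twisted coinvariants as equivariant vectors. -/

section Average

variable {G : Type*} [Group G] {V : Type*} [AddCommGroup V] [Module ℂ V]
  (π : Representation ℂ G V) (U : Subgroup G) (θ : U →* ℂ)

theorem char_ne_zero (u : U) : θ u ≠ 0 := by
  intro h
  have := θ.map_mul u u⁻¹
  simp [h] at this

theorem char_inv_mul_self (u : U) : θ u⁻¹ * θ u = 1 := by
  rw [← map_mul]; simp

theorem char_self_mul_inv (u : U) : θ u * θ u⁻¹ = 1 := by
  rw [← map_mul]; simp

variable [Fintype U]

/-- The projector `|U|⁻¹ ∑ θ(u)⁻¹ π(u)` onto the `(U, θ)`-equivariant vectors. -/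
noncomputable def twistAvg : V →ₗ[ℂ] V :=
  (Fintype.card U : ℂ)⁻¹ • ∑ u : U, θ u⁻¹ • π u

theorem twistAvg_apply (v : V) :
    twistAvg π U θ v = (Fintype.card U : ℂ)⁻¹ • ∑ u : U, θ u⁻¹ • π u v := by
  simp [twistAvg]

theorem apply_twistAvg (u : U) (v : V) : π u (twistAvg π U θ v) = θ u • twistAvg π U θ v := by
  rw [twistAvg_apply, map_smul, map_sum, smul_comm]
  congr 1
  rw [Finset.smul_sum]
  refine Fintype.sum_equiv (Equiv.mulLeft u) _ _ fun x => ?_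
  simp only [map_smul, Equiv.coe_mulLeft, _root_.mul_inv_rev, smul_smul, map_mul, Subgroup.coe_mul,
    Module.End.mul_apply]
  rw [mul_left_comm, char_self_mul_inv, mul_one]

theorem twistAvg_apply_apply (u : U) (v : V) :
    twistAvg π U θ (π u v) = θ u • twistAvg π U θ v := by
  rw [twistAvg_apply, twistAvg_apply, smul_comm]
  congr 1
  rw [Finset.smul_sum]
  refine Fintype.sum_equiv (Equiv.mulRight u) _ _ fun x => ?_
  simp only [Equiv.coe_mulRight, _root_.mul_inv_rev, smul_smul, map_mul, Subgroup.coe_mul,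
    Module.End.mul_apply]
  rw [← mul_assoc, char_self_mul_inv, one_mul]

theorem twistAvg_of_equivariant {v : V} (hv : ∀ u : U, π u v = θ u • v) :
    twistAvg π U θ v = v := by
  rw [twistAvg_apply]
  simp only [hv, smul_smul, char_inv_mul_self]
  rw [Finset.sum_const, Finset.card_univ, one_smul, ← Nat.cast_smul_eq_nsmul ℂ, smul_smul,
    inv_mul_cancel₀ (by simp), one_smul]

theorem mk_apply_twistSpan (u : U) (v : V) :
    (twistSpan π U θ).mkQ (π u v) = θ u • (twistSpan π U θ).mkQ v := by
  rw [← sub_eq_zero, ← map_smul, ← map_sub, Submodule.mkQ_apply, Submodule.Quotient.mk_eq_zero]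
  exact Submodule.subset_span ⟨u, v, rfl⟩

/-- Modulo `V(U, θ)` every term `θ(u)⁻¹ π(u) v` of the average equals `v`. With
`twistSpan_le_ker_twistAvg`, this makes `V(U, θ)` exactly the kernel of the projector. -/
theorem mk_twistAvg (v : V) : (twistSpan π U θ).mkQ (twistAvg π U θ v) = (twistSpan π U θ).mkQ v := by
  rw [twistAvg_apply, map_smul, map_sum]
  simp only [map_smul, mk_apply_twistSpan, smul_smul, char_inv_mul_self]
  rw [Finset.sum_const, Finset.card_univ, one_smul, ← Nat.cast_smul_eq_nsmul ℂ, smul_smul,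
    inv_mul_cancel₀ (by simp), one_smul]

theorem twistSpan_le_ker_twistAvg : twistSpan π U θ ≤ LinearMap.ker (twistAvg π U θ) := by
  refine Submodule.span_le.2 ?_
  rintro _ ⟨u, v, rfl⟩
  simp [twistAvg_apply_apply]

/-- Conjugation by `g` maps `U` injectively into itself, hence permutes the finite group `U`, and it
preserves `θ`; the sum is merely reindexed. -/
theorem twistAvg_comm {g : G} (hg : g ∈ twistNormalizer U θ) (v : V) :
    twistAvg π U θ (π g v) = π g (twistAvg π U θ v) := by
  rw [twistAvg_apply, twistAvg_apply, map_smul, map_sum]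
  congr 1
  symm
  let c : U → U := fun u => ⟨g * u * g⁻¹, (hg u).1⟩
  have hc : Function.Injective c := fun u u' h => by
    have := congrArg Subtype.val h
    simpa [c] using this
  refine Fintype.sum_equiv (Equiv.ofBijective c (Finite.injective_iff_bijective.1 hc)) _ _
    fun u => ?_
  have h1 : θ (c u)⁻¹ = θ u⁻¹ := by
    have h2 : θ (c u) = θ u := (hg u).2
    have := char_inv_mul_self U θ (c u)
    rw [h2, ← char_inv_mul_self U θ u] at this
    exact mul_right_cancel₀ (char_ne_zero U θ u) this
  rw [Equiv.ofBijective_apply, h1, map_smul, ← Module.End.mul_apply, ← Module.End.mul_apply,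
    ← map_mul, ← map_mul]
  simp [c]

/-- The section of `V → V / V(U, θ)` with values in the `(U, θ)`-equivariant vectors. -/
noncomputable def twistSec : (V ⧸ twistSpan π U θ) →ₗ[ℂ] V :=
  (twistSpan π U θ).liftQ (twistAvg π U θ) (twistSpan_le_ker_twistAvg π U θ)

theorem twistSec_comp_mkQ : twistSec π U θ ∘ₗ (twistSpan π U θ).mkQ = twistAvg π U θ :=
  Submodule.liftQ_mkQ _ _ _

theorem mkQ_comp_twistSec : (twistSpan π U θ).mkQ ∘ₗ twistSec π U θ = LinearMap.id := by
  ext v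
  exact mk_twistAvg π U θ v

theorem comp_twistSec (u : U) : π u ∘ₗ twistSec π U θ = θ u • twistSec π U θ := by
  ext v
  exact apply_twistAvg π U θ u v

theorem twistNormalizer_comp_twistSec (g : twistNormalizer U θ) :
    π g ∘ₗ twistSec π U θ = twistSec π U θ ∘ₗ jacquet π U θ g := by
  ext v
  exact (twistAvg_comm π U θ g.2 v).symm

/-- Averaging in one tensor factor is averaging for `π ⊗ 1`. Equivariance under `N(k,1) × N(k,2)`
can then be used one factor at a time. -/
theorem rTensor_twistAvg_of_equivariant {W : Type*} [AddCommGroup W] [Module ℂ W]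
    {a : TensorProduct ℂ V W} (ha : ∀ u : U, (π u).rTensor W a = θ u • a) :
    (twistAvg π U θ).rTensor W a = a := by
  have e : (twistAvg π U θ).rTensor W =
      twistAvg (π.tprod (Representation.trivial ℂ G W)) U θ := by
    ext v x
    simp [twistAvg_apply, TensorProduct.sum_tmul, ← TensorProduct.smul_tmul']
  rw [e]
  exact twistAvg_of_equivariant _ _ _ ha

theorem lTensor_twistAvg_of_equivariant {W : Type*} [AddCommGroup W] [Module ℂ W]
    {a : TensorProduct ℂ W V} (ha : ∀ u : U, (π u).lTensor W a = θ u • a) :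
    (twistAvg π U θ).lTensor W a = a := by
  have e : (twistAvg π U θ).lTensor W =
      twistAvg ((Representation.trivial ℂ G W).tprod π) U θ := by
    ext x v
    simp [twistAvg_apply, TensorProduct.tmul_sum, TensorProduct.tmul_smul]
  rw [e]
  exact twistAvg_of_equivariant _ _ _ ha

end Average

/-! ### Mackey theory for twisted Jacquet modules of induced representations. -/

section Mackey

open DirectSum

variable {G : Type*} [Group G] {P N H : Subgroup G} {ψ : N →* ℂ}
  {A : Type*} [AddCommGroup A] [Module ℂ A] {ρ : Representation ℂ P A}
  {ι : Type*} {B : ι → Type*} [∀ i, AddCommGroup (B i)] [∀ i, Module ℂ (B i)]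
  {K : ι → Subgroup G} {hK : ∀ i, K i ≤ H} {τ : ∀ i, Representation ℂ (K i) (B i)}
  {w : ι → G} {q : ∀ i, A →ₗ[ℂ] B i} {s : ∀ i, B i →ₗ[ℂ] A}

/-- Functions on `G` prescribed on the double cosets `P wᵢ H N`. -/
theorem exists_equivariant_extension
    (hH : ∀ h : H, h.1 ∈ twistNormalizer N ψ)
    (hstab : ∀ i (z : K i), ∃ p : P, p * w i = w i * z ∧ ρ p ∘ₗ s i = s i ∘ₗ τ i z)
    (hunip : ∀ i (u : N) (p : P), p * w i = w i * u → ρ p ∘ₗ s i = ψ u • s i)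
    (hdisj : ∀ i j (p : P) (h : H) (u : N), p * w i = w j * h * u → i = j ∧ h.1 ∈ K i)
    (f : ∀ i, Representation.coindV (Subgroup.inclusion (hK i)) (τ i)) :
    ∃ φ : G → A, (∀ (p : P) g, φ (p * g) = ρ p (φ g)) ∧ (∀ g (u : N), φ (g * u) = ψ u • φ g) ∧
      ∀ i (h : H), φ (w i * h) = s i ((f i).1 h) := by
  classical
  let R : G → A → Prop := fun g a => ∃ (i : ι) (p : P) (h : H) (u : N),
    g = p * w i * h * u ∧ a = ψ u • ρ p (s i ((f i).1 h))
  have Rp : ∀ (p : P) g a, R g a → R (p * g) (ρ p a) := by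
    rintro p g a ⟨i, p', h, u, rfl, rfl⟩
    exact ⟨i, p * p', h, u, by simp [mul_assoc], by simp⟩
  have Ru : ∀ (u : N) g a, R g a → R (g * u) (ψ u • a) := by
    rintro u g a ⟨i, p', h, u', rfl, rfl⟩
    exact ⟨i, p', h, u' * u, by simp [mul_assoc], by rw [map_mul, smul_smul, mul_comm]⟩
  -- Well-definedness: two expressions of the same `g` must prescribe the same value. As `h`
  -- normalizes `(N, ψ)`, the discrepancy `u' * u⁻¹` can be moved to the left of `h⁻¹` as `u₂`
  -- without changing `ψ`.
  have Rf : ∀ g a a', R g a → R g a' → a = a' := by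
    rintro g a a' ⟨i, p, h, u, e, rfl⟩ ⟨j, p', h', u', e', rfl⟩
    obtain ⟨hm, hψ⟩ := hH h (u' * u⁻¹)
    set u₂ : N := ⟨_, hm⟩
    have key : ((p'⁻¹ * p : P) : G) * w i = w j * (h' * h⁻¹ : H) * u₂ := by
      have := e.symm.trans e'
      have h1 : (p : G) * w i = p' * w j * h' * u' * u⁻¹ * h⁻¹ := by
        rw [← this]; simp [mul_assoc]
      simp only [Subgroup.coe_mul, Subgroup.coe_inv, u₂]
      rw [mul_assoc, h1]; simp [mul_assoc]
    obtain ⟨rfl, hz⟩ := hdisj _ _ _ _ _ key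
    -- The element `h' * h⁻¹` of `K i` is absorbed into `P` through `p₀`; what remains stabilizes `w
    -- i` up to `u₂ ∈ N`, so it acts on the image of `s i` by the scalar `ψ u₂`.
    obtain ⟨p₀, hp₀, hs₀⟩ := hstab i ⟨_, hz⟩
    have key2 : ((p₀⁻¹ * (p'⁻¹ * p) : P) : G) * w i = w i * u₂ := by
      rw [Subgroup.coe_mul, mul_assoc, key]
      have : (p₀⁻¹ : P) * (w i * (h' * h⁻¹ : H)) = w i := by
        rw [Subgroup.coe_inv, inv_mul_eq_iff_eq_mul]; exact hp₀.symm
      rw [← mul_assoc, this]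
    have hs := hunip i _ _ key2
    have e1 : (f i).1 h' = τ i ⟨_, hz⟩ ((f i).1 h) := by
      rw [← (f i).2]
      exact congrArg _ (Subtype.ext (by simp))
    have e2 : ρ p (s i ((f i).1 h)) =
        ρ p' (ρ p₀ (ρ (p₀⁻¹ * (p'⁻¹ * p)) (s i ((f i).1 h)))) := by
      rw [← Module.End.mul_apply, ← Module.End.mul_apply, ← map_mul, ← map_mul]
      simp
    have e3 := LinearMap.congr_fun hs ((f i).1 h)
    have e4 := LinearMap.congr_fun hs₀ ((f i).1 h)
    simp only [LinearMap.comp_apply, LinearMap.smul_apply] at e3 e4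
    have e5 : ψ u * ψ u₂ = ψ u' := by
      rw [hψ, map_mul, mul_left_comm, char_self_mul_inv, mul_one]
    rw [e1, e2, e3, map_smul, e4, map_smul, smul_smul, e5]
  -- The value is `0` off the union of the double cosets `P wᵢ H N`, which is stable under `P` on
  -- the left and `N` on the right.
  let φ : G → A := fun g => if h : ∃ a, R g a then h.choose else 0
  have φ_eq : ∀ g a, R g a → φ g = a := fun g a h => by
    have h' : ∃ a, R g a := ⟨a, h⟩
    simp only [φ, dif_pos h']
    exact Rf _ _ _ h'.choose_spec h
  have φ_zero : ∀ g, (¬ ∃ a, R g a) → φ g = 0 := fun g h => dif_neg h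
  refine ⟨φ, fun p g => ?_, fun g u => ?_, fun i h => φ_eq _ _ ⟨i, 1, h, 1, by simp, by simp⟩⟩
  · by_cases h : ∃ a, R g a
    · obtain ⟨a, ha⟩ := h
      rw [φ_eq _ _ ha, φ_eq _ _ (Rp p _ _ ha)]
    · rw [φ_zero _ h, φ_zero, map_zero]
      rintro ⟨a, ha⟩
      exact h ⟨_, by simpa using Rp p⁻¹ _ _ ha⟩
  · by_cases h : ∃ a, R g a
    · obtain ⟨a, ha⟩ := h
      rw [φ_eq _ _ ha, φ_eq _ _ (Ru u _ _ ha)]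
    · rw [φ_zero _ h, φ_zero, smul_zero]
      rintro ⟨a, ha⟩
      exact h ⟨_, by simpa using Ru u⁻¹ _ _ ha⟩

/-- The twisted Jacquet module of a representation induced from `P`, computed from
representatives `wᵢ` of the double cosets `P \ G / H N` that support `(N, ψ)`-equivariant
functions. -/
theorem nonempty_equiv_directSum_coind [Finite G] [Finite ι]
    (hH : ∀ h : H, h.1 ∈ twistNormalizer N ψ)
    (hstab : ∀ i (z : K i), ∃ p : P, p * w i = w i * z ∧
      q i ∘ₗ ρ p = τ i z ∘ₗ q i ∧ ρ p ∘ₗ s i = s i ∘ₗ τ i z)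
    (hunip : ∀ i (u : N) (p : P), p * w i = w i * u → ρ p ∘ₗ s i = ψ u • s i)
    (hdisj : ∀ i j (p : P) (h : H) (u : N), p * w i = w j * h * u → i = j ∧ h.1 ∈ K i)
    (hqs : ∀ i, q i ∘ₗ s i = LinearMap.id)
    (hsq : ∀ i a, (∀ (u : N) (p : P), p * w i = w i * u → ρ p a = ψ u • a) → s i (q i a) = a)
    (hcover : ∀ g : G, (∃ (i : ι) (p : P) (h : H) (u : N), g = p * w i * h * u) ∨
      ∃ (u : N) (p : P), p * g = g * u ∧ ρ p = 1 ∧ ψ u ≠ 1) :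
    Nonempty (Representation.Equiv
      ((jacquet (Representation.coind P.subtype ρ) N ψ).comp (H.subtype.codRestrict _ hH))
      (Representation.directSum fun i =>
        Representation.coind (Subgroup.inclusion (hK i)) (τ i))) := by
  classical
  have := Fintype.ofFinite N
  have := Fintype.ofFinite ι
  set π := Representation.coind P.subtype ρ
  let res : ∀ i, Representation.coindV P.subtype ρ →ₗ[ℂ]
      Representation.coindV (Subgroup.inclusion (hK i)) (τ i) := fun i =>
    { toFun := fun f => ⟨fun h => q i (f.1 (w i * h)), fun z h => by
        obtain ⟨p, hp, hq, -⟩ := hstab i z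
        have h1 : w i * (Subgroup.inclusion (hK i) z * h : H) = P.subtype p * (w i * h) := by
          simp [← mul_assoc, hp]
        simp only [h1, f.2 p]
        exact LinearMap.congr_fun hq _⟩
      map_add' := fun f f' => by ext; simp
      map_smul' := fun c f => by ext; simp }
  let D := DirectSum.linearEquivFunOnFintype ℂ ι
    (fun i => Representation.coindV (Subgroup.inclusion (hK i)) (τ i))
  let Φ : (_ ⧸ twistSpan π N ψ) →ₗ[ℂ]
      ∀ i, Representation.coindV (Subgroup.inclusion (hK i)) (τ i) :=
    LinearMap.pi res ∘ₗ twistSec π N ψ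
  have hΦ : ∀ f i (h : H), (Φ ((twistSpan π N ψ).mkQ f) i).1 h =
      q i ((twistAvg π N ψ f).1 (w i * h)) := fun f i h => rfl
  have hinj : Function.Injective Φ := by
    rw [injective_iff_map_eq_zero]
    intro x hx
    obtain ⟨f, rfl⟩ := (twistSpan π N ψ).mkQ_surjective x
    rw [← mk_twistAvg]
    set e := twistAvg π N ψ f with he
    have hu : ∀ g (u : N), e.1 (g * u) = ψ u • e.1 g := fun g u =>
      congrFun (congrArg Subtype.val (apply_twistAvg π N ψ u f)) g
    suffices e = 0 by rw [this, map_zero]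
    ext g
    rcases hcover g with ⟨i, p, h, u, rfl⟩ | ⟨u, p, hp, h1, hψ⟩
    · have h0 : e.1 (w i * h) = 0 := by
        have hz : q i (e.1 (w i * h)) = 0 := by
          rw [he, ← hΦ, hx]; rfl
        rw [← hsq i (e.1 (w i * h)), hz, map_zero]
        -- `ρ(p') e(wᵢ h) = e(wᵢ u' h) = e(wᵢ h · h⁻¹ u' h)`, and conjugation by `h⁻¹` preserves
        -- `ψ`; so `hsq` applies to `e(wᵢ h)`.
        intro u' p' hp'
        obtain ⟨hm, hψ'⟩ := hH h⁻¹ u'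
        rw [← hψ', ← hu, ← e.2 p']
        simp only [Subgroup.coe_subtype, Subgroup.coe_inv]
        rw [← mul_assoc, hp']
        exact congrArg _ (by group)
      rw [hu, mul_assoc]
      have := e.2 p (w i * h)
      rw [Subgroup.coe_subtype] at this
      rw [this, h0]
      simp
    -- Here `e(g) = ρ(p) e(g) = e(g u) = ψ(u) e(g)` with `ψ(u) ≠ 1`, so `e(g) = 0`.
    · have h2 := e.2 p g
      rw [Subgroup.coe_subtype, hp, hu, h1] at h2
      have h3 : (ψ u - 1) • e.1 g = 0 := by rw [sub_smul, h2]; simp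
      simpa [sub_eq_zero, hψ] using h3
  have hsurj : Function.Surjective Φ := by
    intro f
    -- The extension is already `(N, ψ)`-equivariant, so averaging fixes it and its class is a
    -- preimage.
    obtain ⟨φ, hp, hu, hw⟩ := exists_equivariant_extension (w := w) (s := s) hH
      (fun i z => (hstab i z).imp fun p h => ⟨h.1, h.2.2⟩) hunip hdisj f
    let φ' : Representation.coindV P.subtype ρ := ⟨φ, hp⟩
    have hφ : twistAvg π N ψ φ' = φ' :=
      twistAvg_of_equivariant _ _ _ fun u => Subtype.ext (funext fun g => hu g u)
    refine ⟨(twistSpan π N ψ).mkQ φ', ?_⟩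
    ext i h
    rw [hΦ, hφ]
    change q i (φ (w i * h)) = _
    rw [hw]
    exact LinearMap.congr_fun (hqs i) _
  refine ⟨Representation.Equiv.mk ((LinearEquiv.ofBijective Φ ⟨hinj, hsurj⟩).trans D.symm) ?_⟩
  intro g
  have hD : ∀ f, D (D.symm (Φ (((jacquet π N ψ).comp (H.subtype.codRestrict _ hH)) g
        ((twistSpan π N ψ).mkQ f)))) =
      D ((Representation.directSum fun i => Representation.coind (Subgroup.inclusion (hK i)) (τ i)) g
        (D.symm (Φ ((twistSpan π N ψ).mkQ f)))) := by
    intro f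
    rw [LinearEquiv.apply_symm_apply]
    ext i h
    have h1 : (D ((Representation.directSum fun i =>
        Representation.coind (Subgroup.inclusion (hK i)) (τ i)) g
          (D.symm (Φ ((twistSpan π N ψ).mkQ f)))) i).1 h =
        (D (D.symm (Φ ((twistSpan π N ψ).mkQ f))) i).1 (h * g) := rfl
    rw [h1, LinearEquiv.apply_symm_apply, hΦ]
    refine (hΦ (π g f) i h).trans ?_
    rw [twistAvg_comm π N ψ (hH g)]
    exact congrArg (fun y => q i ((twistAvg π N ψ f).1 y)) (mul_assoc _ _ _)
  refine LinearMap.ext fun x => ?_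
  obtain ⟨f, rfl⟩ := (twistSpan π N ψ).mkQ_surjective x
  exact D.injective (hD f)

end Mackey

/-! ### Blockwise entries, membership in parabolic subgroups, and the trace. -/

section Entries

variable {F : Type*} [Field F]

theorem forall_e2 {a b m : ℕ} (h : a + b = m) {Q : Fin m → Prop} :
    (∀ i, Q i) ↔ (∀ i, Q (p1 h i)) ∧ ∀ i, Q (p2 h i) := by
  refine ⟨fun H => ⟨fun _ => H _, fun _ => H _⟩, fun ⟨H1, H2⟩ i => ?_⟩
  obtain ⟨i | i, rfl⟩ := (e2 h).surjective i
  exacts [H1 i, H2 i]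

theorem forall_e3 {a b c m : ℕ} (h : a + b + c = m) {Q : Fin m → Prop} :
    (∀ i, Q i) ↔ (∀ i, Q (q1 h i)) ∧ (∀ i, Q (q2 h i)) ∧ ∀ i, Q (q3 h i) := by
  refine ⟨fun H => ⟨fun _ => H _, fun _ => H _, fun _ => H _⟩, fun ⟨H1, H2, H3⟩ i => ?_⟩
  obtain ⟨(i | i) | i, rfl⟩ := (e3 h).surjective i
  exacts [H1 i, H2 i, H3 i]

section
variable {a b m : ℕ} (h : a + b = m)
    (A : Matrix (Fin a) (Fin a) F) (B : Matrix (Fin a) (Fin b) F)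
    (C : Matrix (Fin b) (Fin a) F) (D : Matrix (Fin b) (Fin b) F)

@[simp] theorem mat2_p1_p1 (i j) : mat2 h A B C D (p1 h i) (p1 h j) = A i j := by simp [mat2, p1]
@[simp] theorem mat2_p1_p2 (i j) : mat2 h A B C D (p1 h i) (p2 h j) = B i j := by simp [mat2, p1, p2]
@[simp] theorem mat2_p2_p1 (i j) : mat2 h A B C D (p2 h i) (p1 h j) = C i j := by simp [mat2, p1, p2]
@[simp] theorem mat2_p2_p2 (i j) : mat2 h A B C D (p2 h i) (p2 h j) = D i j := by simp [mat2, p2]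
end

section
variable {a b c m : ℕ} (h : a + b + c = m)
    (A₁₁ : Matrix (Fin a) (Fin a) F) (A₁₂ : Matrix (Fin a) (Fin b) F)
    (A₁₃ : Matrix (Fin a) (Fin c) F)
    (A₂₁ : Matrix (Fin b) (Fin a) F) (A₂₂ : Matrix (Fin b) (Fin b) F)
    (A₂₃ : Matrix (Fin b) (Fin c) F)
    (A₃₁ : Matrix (Fin c) (Fin a) F) (A₃₂ : Matrix (Fin c) (Fin b) F)
    (A₃₃ : Matrix (Fin c) (Fin c) F)

@[simp] theorem mat3_q1_q1 (i j) :
    mat3 h A₁₁ A₁₂ A₁₃ A₂₁ A₂₂ A₂₃ A₃₁ A₃₂ A₃₃ (q1 h i) (q1 h j) = A₁₁ i j := by simp [mat3, q1]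
@[simp] theorem mat3_q1_q2 (i j) :
    mat3 h A₁₁ A₁₂ A₁₃ A₂₁ A₂₂ A₂₃ A₃₁ A₃₂ A₃₃ (q1 h i) (q2 h j) = A₁₂ i j := by
  simp [mat3, q1, q2]
@[simp] theorem mat3_q1_q3 (i j) :
    mat3 h A₁₁ A₁₂ A₁₃ A₂₁ A₂₂ A₂₃ A₃₁ A₃₂ A₃₃ (q1 h i) (q3 h j) = A₁₃ i j := by
  simp [mat3, q1, q3]
@[simp] theorem mat3_q2_q1 (i j) :
    mat3 h A₁₁ A₁₂ A₁₃ A₂₁ A₂₂ A₂₃ A₃₁ A₃₂ A₃₃ (q2 h i) (q1 h j) = A₂₁ i j := by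
  simp [mat3, q1, q2]
@[simp] theorem mat3_q2_q2 (i j) :
    mat3 h A₁₁ A₁₂ A₁₃ A₂₁ A₂₂ A₂₃ A₃₁ A₃₂ A₃₃ (q2 h i) (q2 h j) = A₂₂ i j := by simp [mat3, q2]
@[simp] theorem mat3_q2_q3 (i j) :
    mat3 h A₁₁ A₁₂ A₁₃ A₂₁ A₂₂ A₂₃ A₃₁ A₃₂ A₃₃ (q2 h i) (q3 h j) = A₂₃ i j := by
  simp [mat3, q2, q3]
@[simp] theorem mat3_q3_q1 (i j) :
    mat3 h A₁₁ A₁₂ A₁₃ A₂₁ A₂₂ A₂₃ A₃₁ A₃₂ A₃₃ (q3 h i) (q1 h j) = A₃₁ i j := by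
  simp [mat3, q3, q1]
@[simp] theorem mat3_q3_q2 (i j) :
    mat3 h A₁₁ A₁₂ A₁₃ A₂₁ A₂₂ A₂₃ A₃₁ A₃₂ A₃₃ (q3 h i) (q2 h j) = A₃₂ i j := by
  simp [mat3, q3, q2]
@[simp] theorem mat3_q3_q3 (i j) :
    mat3 h A₁₁ A₁₂ A₁₃ A₂₁ A₂₂ A₂₃ A₃₁ A₃₂ A₃₃ (q3 h i) (q3 h j) = A₃₃ i j := by simp [mat3, q3]

end

theorem mem_parabolic2 {a b m : ℕ} (h : a + b = m) {g : GL (Fin m) F} :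
    g ∈ parabolic2 F h ↔ ∀ i j, g.1 (p2 h i) (p1 h j) = 0 := by
  refine ⟨fun hg i j => hg (by simp [p1, p2]), fun H => ?_⟩
  change BlockTriangular g.1 _
  refine (forall_e2 h).2 ⟨fun i => (forall_e2 h).2 ⟨fun j => ?_, fun j => ?_⟩,
    fun i => (forall_e2 h).2 ⟨fun j _ => H i j, fun j => ?_⟩⟩ <;> simp [p1, p2]

theorem mem_parabolic3 {a b c m : ℕ} (h : a + b + c = m) {g : GL (Fin m) F} :
    g ∈ parabolic3 F h ↔ (∀ i j, g.1 (q2 h i) (q1 h j) = 0) ∧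
      (∀ i j, g.1 (q3 h i) (q1 h j) = 0) ∧ ∀ i j, g.1 (q3 h i) (q2 h j) = 0 := by
  refine ⟨fun hg => ⟨fun i j => hg (by simp [q1, q2]), fun i j => hg (by simp [q1, q3]),
    fun i j => hg (by simp [q2, q3])⟩, fun ⟨h21, h31, h32⟩ => ?_⟩
  change BlockTriangular g.1 _
  refine (forall_e3 h).2 ⟨fun i => (forall_e3 h).2 ⟨fun j => ?_, fun j => ?_, fun j => ?_⟩,
    fun i => (forall_e3 h).2 ⟨fun j _ => h21 i j, fun j => ?_, fun j => ?_⟩,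
    fun i => (forall_e3 h).2 ⟨fun j _ => h31 i j, fun j _ => h32 i j, fun j => ?_⟩⟩ <;>
  simp [q1, q2, q3]

theorem trace_eq_q {a b c m : ℕ} (h : a + b + c = m) (M : Matrix (Fin m) (Fin m) F) :
    trace M = trace (M.submatrix (q1 h) (q1 h)) + trace (M.submatrix (q2 h) (q2 h)) +
      trace (M.submatrix (q3 h) (q3 h)) := by
  simp only [trace, ← (e3 h).sum_comp, Fintype.sum_sum_type]
  rfl

end Entries

/-! ### The permutation representatives: their stabilizers, and the rank that separates them. -/

section Representatives

variable {F : Type*} [Field F] {a b c n r s : ℕ} (h : a + b + c = n) (hr : a + a + b = r)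
  (hs : b + c + c = s) (hm : r + s = 2 * n)

/-- The rearrangement of the blocks `(a, a, b | b, c, c)` into `(a, b, c | a, b, c)`. -/
def blockShuffle (α β γ : Type*) :
    ((α ⊕ α) ⊕ β) ⊕ ((β ⊕ γ) ⊕ γ) ≃ ((α ⊕ β) ⊕ γ) ⊕ ((α ⊕ β) ⊕ γ) where
  toFun
    | .inl (.inl (.inl i)) => .inl (.inl (.inl i))
    | .inl (.inl (.inr i)) => .inr (.inl (.inl i))
    | .inl (.inr i) => .inr (.inl (.inr i))
    | .inr (.inl (.inl i)) => .inl (.inl (.inr i))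
    | .inr (.inl (.inr i)) => .inl (.inr i)
    | .inr (.inr i) => .inr (.inr i)
  invFun
    | .inl (.inl (.inl i)) => .inl (.inl (.inl i))
    | .inr (.inl (.inl i)) => .inl (.inl (.inr i))
    | .inr (.inl (.inr i)) => .inl (.inr i)
    | .inl (.inl (.inr i)) => .inr (.inl (.inl i))
    | .inl (.inr i) => .inr (.inl (.inr i))
    | .inr (.inr i) => .inr (.inr i)
  left_inv := by rintro (((i | i) | i) | ((i | i) | i)) <;> rfl
  right_inv := by rintro (((i | i) | i) | ((i | i) | i)) <;> rfl

/-- The permutation of `{0, …, 2n-1}` underlying `doubleCosetRep`. -/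
def doubleCosetPerm : Equiv.Perm (Fin (2 * n)) :=
  (((Equiv.sumCongr (e3 hr) (e3 hs)).trans (e2 hm)).symm.trans
    (blockShuffle (Fin a) (Fin b) (Fin c))).trans
      ((Equiv.sumCongr (e3 h) (e3 h)).trans (e2 (two_mul n).symm))

section
local notation "σ" => doubleCosetPerm h hr hs hm
local notation "tn" => Eq.symm (two_mul n)

@[simp] theorem doubleCosetPerm_11 (i) : σ (p1 hm (q1 hr i)) = p1 tn (q1 h i) := by
  simp [doubleCosetPerm, p1, q1, blockShuffle]
@[simp] theorem doubleCosetPerm_12 (i) : σ (p1 hm (q2 hr i)) = p2 tn (q1 h i) := by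
  simp [doubleCosetPerm, p1, p2, q1, q2, blockShuffle]
@[simp] theorem doubleCosetPerm_13 (i) : σ (p1 hm (q3 hr i)) = p2 tn (q2 h i) := by
  simp [doubleCosetPerm, p1, p2, q2, q3, blockShuffle]
@[simp] theorem doubleCosetPerm_21 (i) : σ (p2 hm (q1 hs i)) = p1 tn (q2 h i) := by
  simp [doubleCosetPerm, p1, p2, q1, q2, blockShuffle]
@[simp] theorem doubleCosetPerm_22 (i) : σ (p2 hm (q2 hs i)) = p1 tn (q3 h i) := by
  simp [doubleCosetPerm, p1, p2, q2, q3, blockShuffle]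
@[simp] theorem doubleCosetPerm_23 (i) : σ (p2 hm (q3 hs i)) = p2 tn (q3 h i) := by
  simp [doubleCosetPerm, p2, q3, blockShuffle]

end

/-- The permutation matrix of a permutation, as an element of `GL_m`. -/
def permGL (F : Type*) [Field F] {m : ℕ} (σ : Equiv.Perm (Fin m)) : GL (Fin m) F where
  val := (1 : Matrix (Fin m) (Fin m) F).submatrix σ id
  inv := (1 : Matrix (Fin m) (Fin m) F).submatrix id σ
  val_inv := by
    rw [← Matrix.submatrix_mul _ _ _ _ _ Function.bijective_id]; simp
  inv_val := by
    rw [← Matrix.submatrix_mul _ _ _ _ _ σ.bijective]; simp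

theorem permGL_mul {m : ℕ} (σ : Equiv.Perm (Fin m)) (M : Matrix (Fin m) (Fin m) F) :
    (permGL F σ).1 * M = M.submatrix σ id := by
  change (1 : Matrix (Fin m) (Fin m) F).submatrix σ id * M.submatrix id id = _
  rw [← Matrix.submatrix_mul _ _ _ _ _ Function.bijective_id, Matrix.one_mul]

/-- Conjugation by a permutation matrix permutes rows and columns, so every stabilizer condition
below becomes a comparison of blocks. -/
theorem mul_permGL_iff {m : ℕ} (σ : Equiv.Perm (Fin m)) (p M : GL (Fin m) F) :
    p * permGL F σ = permGL F σ * M ↔ p.1 = M.1.submatrix σ σ := by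
  rw [← eq_mul_inv_iff_mul_eq, Units.ext_iff, Units.val_mul, Units.val_mul, permGL_mul]
  change _ = _ * (1 : Matrix (Fin m) (Fin m) F).submatrix id σ ↔ _
  have : M.1.submatrix σ id * (1 : Matrix (Fin m) (Fin m) F).submatrix id σ =
      M.1.submatrix σ σ := by
    rw [← Matrix.submatrix_mul _ _ _ _ _ Function.bijective_id]; simp
  rw [this]

/-- The representative `w` of a double coset `P \ GL_{2n} / ΔGL_n N`. -/
def doubleCosetRep (F : Type*) [Field F] : GL (Fin (2 * n)) F :=
  permGL F (doubleCosetPerm h hr hs hm)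

theorem diag_val (g : GL (Fin n) F) : (diag F n g).1 = mat2 (two_mul n).symm g.1 0 0 g.1 := rfl

theorem exists_unipN (x : Matrix (Fin n) (Fin n) F) :
    ∃ u : unipN F n, u.1.1 = mat2 (two_mul n).symm 1 x 0 1 := by
  refine ⟨⟨⟨mat2 (two_mul n).symm 1 x 0 1, mat2 (two_mul n).symm 1 (-x) 0 1, ?_, ?_⟩, x, rfl⟩, rfl⟩
  all_goals rw [mat2_mul, ← mat2_one (two_mul n).symm]; simp

/-- The lower left block of `p` contains the `(2,1)` and `(3,1)` blocks of the upper copy of `g` and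
the `(3,2)` block of the lower copy, and these must vanish. -/
theorem diag_mem_parabolic3 (p : parabolic2 F hm) (g : GL (Fin n) F) (u : unipN F n)
    (hp : p.1 * doubleCosetRep h hr hs hm F = doubleCosetRep h hr hs hm F * (diag F n g * u)) :
    g ∈ parabolic3 F h := by
  obtain ⟨u, x, hx⟩ := u
  rw [doubleCosetRep, mul_permGL_iff, Units.val_mul, hx, diag_val, mat2_mul] at hp
  have hp' := (mem_parabolic2 hm).1 p.2
  rw [hp] at hp'
  refine (mem_parabolic3 h).2 ⟨fun i j => ?_, fun i j => ?_, fun i j => ?_⟩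
  · simpa [doubleCosetPerm_11, doubleCosetPerm_21, mat2_p1_p1] using hp' (q1 hs i) (q1 hr j)
  · simpa [doubleCosetPerm_11, doubleCosetPerm_22, mat2_p1_p1] using hp' (q2 hs i) (q1 hr j)
  · simpa [doubleCosetPerm_13, doubleCosetPerm_23, mat2_p2_p2] using hp' (q3 hs i) (q3 hr j)

theorem exists_parabolic2_of_parabolic3 (g : parabolic3 F h) :
    ∃ p : parabolic2 F hm,
      p.1 * doubleCosetRep h hr hs hm F = doubleCosetRep h hr hs hm F * diag F n g ∧
      levi1 hm p = toFirst h hr g ∧ levi2 hm p = toSecond h hs g := by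
  obtain ⟨h21, h31, h32⟩ := (mem_parabolic3 h).1 g.2
  set w := doubleCosetRep h hr hs hm F with hw
  obtain ⟨p, hp⟩ : ∃ p, p * w = w * diag F n g := ⟨w * diag F n g * w⁻¹, by simp⟩
  have e := hp
  rw [hw, doubleCosetRep, mul_permGL_iff, diag_val] at e
  have hmem : p ∈ parabolic2 F hm := by
    rw [mem_parabolic2, e]
    simp [forall_e3 hs, forall_e3 hr, h21, h31, h32]
  refine ⟨⟨p, hmem⟩, hp, Units.ext (Matrix.ext ?_), Units.ext (Matrix.ext ?_)⟩
  · change ∀ i j, p.1 (p1 hm i) (p1 hm j) = mat3 hr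
        (g.1.1.submatrix (q1 h) (q1 h)) 0 0
        0 (g.1.1.submatrix (q1 h) (q1 h)) (g.1.1.submatrix (q1 h) (q2 h))
        0 0 (g.1.1.submatrix (q2 h) (q2 h)) i j
    simp [e, forall_e3 hr, h21, h31, h32]
  · change ∀ i j, p.1 (p2 hm i) (p2 hm j) = mat3 hs
        (g.1.1.submatrix (q2 h) (q2 h)) (g.1.1.submatrix (q2 h) (q3 h)) 0
        0 (g.1.1.submatrix (q3 h) (q3 h)) 0
        0 0 (g.1.1.submatrix (q3 h) (q3 h)) i j
    simp [e, forall_e3 hs, h21, h31, h32]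

theorem one_eq_mat3 (h : a + b + c = n) : ((1 : Matrix (Fin n) (Fin n) F) = mat3 h 1 0 0 0 1 0 0 0 1) :=
  (mat3_one h).symm

theorem levi_mem_unip (ψ₀ : AddChar F ℂ) (u : unipN F n) (p : parabolic2 F hm)
    (hp : p.1 * doubleCosetRep h hr hs hm F = doubleCosetRep h hr hs hm F * u.1) :
    ∃ (h₁ : levi1 hm p ∈ unip1 F hr) (h₂ : levi2 hm p ∈ unip2 F hs),
      psi ψ₀ n u = psi1 ψ₀ hr ⟨_, h₁⟩ * psi2 ψ₀ hs ⟨_, h₂⟩ := by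
  obtain ⟨u, x, hx⟩ := u
  have e := hp
  rw [doubleCosetRep, mul_permGL_iff, hx] at e
  have hp' := (mem_parabolic2 hm).1 p.2
  rw [e] at hp'
  simp only [forall_e3 hs, forall_e3 hr, submatrix_apply, doubleCosetPerm_11, doubleCosetPerm_12,
      doubleCosetPerm_13, doubleCosetPerm_21, doubleCosetPerm_22, doubleCosetPerm_23,
      mat2_p1_p1, mat2_p1_p2, mat2_p2_p1, mat2_p2_p2] at hp'
  -- The middle diagonal block of `x` sits in the lower left block of `p`. Its vanishing leaves only
  -- the two diagonal blocks seen by `psi1` and `psi2` in the trace of `x`.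
  have x22 : x.submatrix (q2 h) (q2 h) = 0 := by
    ext i j; exact ((hp'.1 i).2.2 j)
  have e1 : (levi1 hm p).1 = mat3 hr 1 (x.submatrix (q1 h) (q1 h)) (x.submatrix (q1 h) (q2 h))
      0 1 0 0 0 1 := by
    refine Matrix.ext ?_
    change ∀ i j, p.1.1 (p1 hm i) (p1 hm j) = _
    simp [e, one_eq_mat3 h, forall_e3 hr]
  have e2 : (levi2 hm p).1 = mat3 hs 1 0 (x.submatrix (q2 h) (q3 h))
      0 1 (x.submatrix (q3 h) (q3 h)) 0 0 1 := by
    refine Matrix.ext ?_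
    change ∀ i j, p.1.1 (p2 hm i) (p2 hm j) = _
    simp [e, one_eq_mat3 h, forall_e3 hs]
  refine ⟨⟨_, _, e1⟩, ⟨_, _, e2⟩, ?_⟩
  change ψ₀ (trace (u.1.submatrix _ _)) = ψ₀ (trace ((levi1 hm p).1.submatrix _ _)) *
    ψ₀ (trace ((levi2 hm p).1.submatrix _ _))
  rw [hx, mat2_12, e1, mat3_12, e2, mat3_23, trace_eq_q h, x22, trace_zero, add_zero,
    AddChar.map_add_eq_mul]

/-- Together with `levi_mem_unip` this shows that the condition imposed by the stabilizer in `N` is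
full `N(k,1) × N(k,2)`-equivariance. -/
theorem exists_of_unip (u₁ : unip1 F hr) (u₂ : unip2 F hs) :
    ∃ (u : unipN F n) (p : parabolic2 F hm),
      p.1 * doubleCosetRep h hr hs hm F = doubleCosetRep h hr hs hm F * u.1 ∧
      levi1 hm p = u₁ ∧ levi2 hm p = u₂ := by
  obtain ⟨u₁, x, y, h₁⟩ := u₁
  obtain ⟨u₂, x', z, h₂⟩ := u₂
  -- The blocks in positions `(2,1)`, `(2,2)`, `(3,1)`, `(3,2)` must vanish for `p` to be in `P`.
  -- The `(1,3)` block lands in the unipotent radical of `P`, so any value, here `0`, would do.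
  obtain ⟨u, hu⟩ := exists_unipN (mat3 h x y 0 0 0 x' 0 0 z)
  set w := doubleCosetRep h hr hs hm F with hw
  obtain ⟨p, hp⟩ : ∃ p, p * w = w * u := ⟨w * u * w⁻¹, by simp⟩
  have e := hp
  rw [hw, doubleCosetRep, mul_permGL_iff, hu] at e
  have hmem : p ∈ parabolic2 F hm := by
    rw [mem_parabolic2, e, one_eq_mat3 h]
    simp [forall_e3 hs, forall_e3 hr]
  refine ⟨u, ⟨p, hmem⟩, hp, Units.ext (Matrix.ext ?_), Units.ext (Matrix.ext ?_)⟩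
  · change ∀ i j, p.1 (p1 hm i) (p1 hm j) = u₁.1 i j
    simp [e, h₁, one_eq_mat3 h, forall_e3 hr]
  · change ∀ i j, p.1 (p2 hm i) (p2 hm j) = u₂.1 i j
    simp [e, h₂, one_eq_mat3 h, forall_e3 hs]

theorem doubleCosetRep_lowerLeft :
    (doubleCosetRep h hr hs hm F).1.submatrix (p2 hm) (p1 (two_mul n).symm) =
      (1 : Matrix (Fin s) (Fin s) F).submatrix id (Sum.elim (q1 hs) (q2 hs)) *
        (1 : Matrix (Fin n) (Fin n) F).submatrix (Sum.elim (q2 h) (q3 h)) id := by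
  refine Matrix.ext ?_
  rw [one_eq_mat3 hs, one_eq_mat3 h]
  have e : (doubleCosetRep h hr hs hm F).1 = (mat2 (two_mul n).symm 1 0 0 1).submatrix
    (doubleCosetPerm h hr hs hm) id := by rw [mat2_one]; rfl
  simp only [e, one_eq_mat3 h, forall_e3 hs, forall_e3 h, submatrix_apply, doubleCosetPerm_21,
      doubleCosetPerm_22, doubleCosetPerm_23, mul_apply, Fintype.sum_sum_type, Sum.elim_inl,
      Sum.elim_inr, id,
      mat2_p1_p1, mat2_p1_p2, mat2_p2_p1, mat2_p2_p2,
      mat3_q1_q1, mat3_q1_q2, mat3_q1_q3, mat3_q2_q1, mat3_q2_q2, mat3_q2_q3,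
      mat3_q3_q1, mat3_q3_q2, mat3_q3_q3]
  simp [Matrix.one_apply]

theorem rank_doubleCosetRep_lowerLeft :
    ((doubleCosetRep h hr hs hm F).1.submatrix (p2 hm) (p1 (two_mul n).symm)).rank = b + c := by
  rw [doubleCosetRep_lowerLeft]
  apply le_antisymm
  · refine (rank_mul_le_left _ _).trans ((rank_le_card_width _).trans ?_)
    simp
  -- Lower bound for the rank: the transposed selection matrices on both sides recover the identity
  -- of size `b + c`.
  · have e : (1 : Matrix (Fin s) (Fin s) F).submatrix (Sum.elim (q1 hs) (q2 hs)) id *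
        ((1 : Matrix (Fin s) (Fin s) F).submatrix id (Sum.elim (q1 hs) (q2 hs)) *
          (1 : Matrix (Fin n) (Fin n) F).submatrix (Sum.elim (q2 h) (q3 h)) id) *
        (1 : Matrix (Fin n) (Fin n) F).submatrix id (Sum.elim (q2 h) (q3 h)) =
        (1 : Matrix (Fin b ⊕ Fin c) (Fin b ⊕ Fin c) F) := by
      have h1 : Function.Injective (Sum.elim (q1 hs) (q2 hs)) := by
        have : Sum.elim (q1 hs) (q2 hs) = e3 hs ∘ Sum.inl := by ext (i | i) <;> rfl
        rw [this]; exact (e3 hs).injective.comp Sum.inl_injective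
      have h2 : Function.Injective (Sum.elim (q2 h) (q3 h)) := by
        have : Sum.elim (q2 h) (q3 h) = e3 h ∘ Sum.map Sum.inr id := by ext (i | i) <;> rfl
        rw [this]
        exact (e3 h).injective.comp (Sum.map_injective.2 ⟨Sum.inr_injective, fun _ _ h => h⟩)
      rw [← Matrix.mul_assoc, Matrix.mul_assoc,
        ← Matrix.submatrix_mul _ _ _ _ _ Function.bijective_id,
        ← Matrix.submatrix_mul _ _ _ _ _ Function.bijective_id, Matrix.one_mul, Matrix.one_mul,
        submatrix_one _ h1, submatrix_one _ h2, Matrix.one_mul]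
    have := congrArg rank e
    rw [rank_one, Fintype.card_sum, Fintype.card_fin, Fintype.card_fin] at this
    rw [← this]
    exact (rank_mul_le_left _ _).trans (rank_mul_le_right _ _)

/-- On the lower left block, `P` acts on the left through its second Levi factor, `diag g` on the
right through `g`, and `N` trivially. -/
theorem rank_lowerLeft_eq (p : parabolic2 F hm) (w w' : GL (Fin (2 * n)) F) (g : GL (Fin n) F)
    (u : unipN F n) (hp : p.1 * w = w' * (diag F n g * u)) :
    (w.1.submatrix (p2 hm) (p1 (two_mul n).symm)).rank =
      (w'.1.submatrix (p2 hm) (p1 (two_mul n).symm)).rank := by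
  obtain ⟨u, x, hx⟩ := u
  have e1 : (p.1 * w).1.submatrix (p2 hm) (p1 (two_mul n).symm) =
      (levi2 hm p).1 * w.1.submatrix (p2 hm) (p1 (two_mul n).symm) := by
    refine Matrix.ext fun i j => ?_
    have h0 := (mem_parabolic2 hm).1 p.2
    simp only [submatrix_apply, Units.val_mul, mul_apply, ← (e2 hm).sum_comp, Fintype.sum_sum_type]
    rw [Finset.sum_eq_zero fun k _ => ?_, zero_add]
    · rfl
    · exact mul_eq_zero_of_left (h0 i k) _
  have e2 : (w' * (diag F n g * u)).1.submatrix (p2 hm) (p1 (two_mul n).symm) =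
      w'.1.submatrix (p2 hm) (p1 (two_mul n).symm) * g.1 := by
    refine Matrix.ext fun i j => ?_
    rw [Units.val_mul, Units.val_mul, hx, diag_val, mat2_mul]
    simp only [submatrix_apply, mul_apply, ← (e2 (two_mul n).symm).sum_comp,
      Fintype.sum_sum_type]
    change ∑ k, w'.1 _ (p1 _ k) * mat2 _ _ _ _ _ (p1 _ k) _ +
      ∑ k, w'.1 _ (p2 _ k) * mat2 _ _ _ _ _ (p2 _ k) _ = _
    simp [mat2_p1_p1, mat2_p2_p1]
  have e3 := e1.symm.trans ((congrArg (fun M : GL (Fin (2 * n)) F =>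
    M.1.submatrix (p2 hm) (p1 (two_mul n).symm)) hp).trans e2)
  have e4 := congrArg rank e3
  rwa [rank_mul_eq_right_of_isUnit_det _ _ ((isUnit_iff_isUnit_det _).1 (Units.isUnit _)),
    rank_mul_eq_left_of_isUnit_det _ _ ((isUnit_iff_isUnit_det _).1 (Units.isUnit _))] at e4

end Representatives

/-! ### Classification of the double cosets by a flag in `F^n`. -/

section Cover

variable {F : Type*} [Field F]

/-- A basis of a complement is placed before the given one, so that smaller subspaces of a flag
occupy the later rows. -/
theorem exists_basis_extending {V : Type*} [AddCommGroup V] [Module F V] [FiniteDimensional F V]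
    {X : Submodule F V} {κ : Type*} [Fintype κ] (bX : Module.Basis κ F X) {b : ℕ}
    (hV : Module.finrank F V = b + Fintype.card κ) :
    ∃ B : Module.Basis (Fin b ⊕ κ) F V, ∀ i, B (.inr i) = bX i := by
  obtain ⟨Y, hY⟩ := Submodule.exists_isCompl X
  have dY : Module.finrank F Y = b := by
    have h1 := Submodule.finrank_add_eq_of_isCompl hY
    have h2 := Module.finrank_eq_card_basis bX
    omega
  refine ⟨((Module.finBasisOfFinrankEq F _ dY).prod bX).map
    (Submodule.prodEquivOfIsCompl _ _ hY.symm), fun i => ?_⟩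
  simp

/-- A two-step flag of subspaces of `F^n` has an adapted basis, written as the rows of a matrix. -/
theorem exists_adapted_rows {a b c n : ℕ} (h : a + b + c = n) {W₁ W₂ : Submodule F (Fin n → F)}
    (hle : W₂ ≤ W₁) (h₁ : Module.finrank F W₁ = b + c) (h₂ : Module.finrank F W₂ = c) :
    ∃ g : GL (Fin n) F, (∀ i, g.1 (q2 h i) ∈ W₁) ∧ ∀ i, g.1 (q3 h i) ∈ W₂ := by
  let b₂ := Module.finBasisOfFinrankEq F _ h₂
  obtain ⟨b₁, hb₁⟩ := exists_basis_extending
    (b₂.map (Submodule.comapSubtypeEquivOfLe hle).symm) (b := b) (by simpa using h₁)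
  obtain ⟨b₀, hb₀⟩ := exists_basis_extending b₁ (b := a) (by simp; omega)
  let B : Module.Basis (Fin n) F (Fin n → F) :=
    b₀.reindex ((Equiv.sumAssoc _ _ _).symm.trans (e3 h))
  have hu : IsUnit (Matrix.of fun i j => B i j : Matrix (Fin n) (Fin n) F) :=
    Matrix.linearIndependent_rows_iff_isUnit.1 B.linearIndependent
  refine ⟨hu.unit, fun i => ?_, fun i => ?_⟩
  · have : hu.unit.1 (q2 h i) = (b₁ (.inl i) : Fin n → F) := by
      change B (q2 h i) = _
      simp [B, q2, hb₀]
    rw [this]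
    exact (b₁ _).2
  · have : hu.unit.1 (q3 h i) = (b₂ i : Fin n → F) := by
      change B (q3 h i) = _
      simp [B, q3, hb₀, hb₁]
    rw [this]
    exact (b₂ i).2

variable {r s n : ℕ} (hm : r + s = 2 * n)

theorem eq_fromBlocks {r' s' m : ℕ} (hm : r + s = m) (h' : r' + s' = m)
    (M : Matrix (Fin m) (Fin m) F) :
    M = (fromBlocks (M.submatrix (p1 hm) (p1 h')) (M.submatrix (p1 hm) (p2 h'))
      (M.submatrix (p2 hm) (p1 h')) (M.submatrix (p2 hm) (p2 h'))).submatrix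
        (e2 hm).symm (e2 h').symm := by
  ext i j
  obtain ⟨i | i, rfl⟩ := (e2 hm).surjective i <;> obtain ⟨j | j, rfl⟩ := (e2 h').surjective j <;>
    simp [p1, p2]

/-- With `x = t l (v B₂)`, the relations `B₁ l = 0` and `v B₁ = 0` give `g u = p g` for a `p` in the
unipotent radical of `P`, with upper right block `t (A₁ l) v`; and `tr x = t (v B₂) l = t`. -/
theorem exists_unipotent_stabilizer (g : GL (Fin (2 * n)) F) (ψ₀ : AddChar F ℂ)
    {v : Fin s → F} {l : Fin n → F}
    (h₁ : v ᵥ* g.1.submatrix (p2 hm) (p1 (two_mul n).symm) = 0)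
    (h₂ : g.1.submatrix (p2 hm) (p1 (two_mul n).symm) *ᵥ l = 0)
    (h₃ : (v ᵥ* g.1.submatrix (p2 hm) (p2 (two_mul n).symm)) ⬝ᵥ l = 1) (t : F) :
    ∃ (u : unipN F n) (p : parabolic2 F hm), p.1 * g = g * u.1 ∧ levi1 hm p = 1 ∧ levi2 hm p = 1 ∧
      psi ψ₀ n u = ψ₀ t := by
  set tn := (two_mul n).symm
  set A₁ := g.1.submatrix (p1 hm) (p1 tn)
  set A₂ := g.1.submatrix (p1 hm) (p2 tn)
  set B₁ := g.1.submatrix (p2 hm) (p1 tn)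
  set B₂ := g.1.submatrix (p2 hm) (p2 tn)
  obtain ⟨u, hu⟩ := exists_unipN (t • vecMulVec l (v ᵥ* B₂))
  obtain ⟨p, hp⟩ : ∃ p, p * g = g * u.1 := ⟨g * u.1 * g⁻¹, by simp⟩
  have hval : p.1 = mat2 hm 1 (t • vecMulVec (A₁ *ᵥ l) v) 0 1 := by
    have : p.1 = (g * u.1).1 * (g⁻¹).1 := by rw [← hp]; simp
    have e : mat2 hm 1 (t • vecMulVec (A₁ *ᵥ l) v) 0 1 * g.1 = (g * u.1).1 := by
      rw [Units.val_mul, hu, eq_fromBlocks hm tn g.1, mat2, mat2, submatrix_mul_equiv,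
        submatrix_mul_equiv, fromBlocks_multiply, fromBlocks_multiply]
      congr 2
      · simp only [smul_mul, vecMulVec_mul, A₁, B₁, h₁]
        ext
        simp [vecMulVec]
      · simp [vecMulVec_mul, mul_vecMulVec, A₁, B₂, add_comm]
      · simp
      · simp [mul_vecMulVec, h₂, B₂, B₁]
    rw [this, ← e, Matrix.mul_assoc, ← Units.val_mul]
    simp
  have hmem : p ∈ parabolic2 F hm := by
    rw [mem_parabolic2, hval]; simp
  refine ⟨u, ⟨p, hmem⟩, hp, ?_, ?_, ?_⟩
  · refine Units.ext ?_
    change p.1.submatrix (p1 hm) (p1 hm) = 1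
    rw [hval, mat2_11]
  · refine Units.ext ?_
    change p.1.submatrix (p2 hm) (p2 hm) = 1
    rw [hval, mat2_22]
  · change ψ₀ (trace (u.1.1.submatrix _ _)) = _
    rw [hu, mat2_12, trace_smul, trace_vecMulVec, dotProduct_comm, h₃]
    simp

theorem exists_eq_mul_doubleCosetRep {a b c : ℕ} (h : a + b + c = n) (hr : a + a + b = r)
    (hs : b + c + c = s) (g : GL (Fin (2 * n)) F)
    {f₁ f₂ : (Fin s → F) →ₗ[F] (Fin n → F)}
    (hf₁ : ∀ v, f₁ v = v ᵥ* g.1.submatrix (p2 hm) (p1 (two_mul n).symm))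
    (hf₂ : ∀ v, f₂ v = v ᵥ* g.1.submatrix (p2 hm) (p2 (two_mul n).symm))
    (hle : (LinearMap.ker f₁).map f₂ ≤ LinearMap.range f₁)
    (hd₁ : Module.finrank F (LinearMap.range f₁) = b + c)
    (hd₂ : Module.finrank F ((LinearMap.ker f₁).map f₂) = c) :
    ∃ (p : parabolic2 F hm) (y : GL (Fin n) F) (u : unipN F n),
      g = p.1 * doubleCosetRep h hr hs hm F * diag F n y * u := by
  obtain ⟨y, hy₁, hy₂⟩ := exists_adapted_rows h hle hd₁ hd₂
  -- A linear section `ρ` of `f₁` over its range gives `f₂ ∘ ρ` there; `x` is the matrix of any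
  -- extension to `F^n`, so each `z` in the range satisfies `(z, z x) = (f₁ d, f₂ d)` for some `d`.
  obtain ⟨ρ, hρ⟩ := f₁.rangeRestrict.exists_rightInverse_of_surjective f₁.range_rangeRestrict
  obtain ⟨f, hf⟩ := (f₂ ∘ₗ ρ).exists_extend
  obtain ⟨x, rfl⟩ := (Matrix.toLinearMapRight' (R := F)).surjective f
  obtain ⟨u, hu⟩ := exists_unipN x
  have lift : ∀ z ∈ LinearMap.range f₁, ∃ d, f₁ d = z ∧ f₂ d = z ᵥ* x := fun z hz =>
    ⟨ρ ⟨z, hz⟩, congrArg Subtype.val (LinearMap.congr_fun hρ ⟨z, hz⟩),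
      (LinearMap.congr_fun hf ⟨z, hz⟩).symm⟩
  set w := doubleCosetRep h hr hs hm F with hw
  set Z := w * (diag F n y * u) with hZ
  have Zval : Z.1 = (mat2 (two_mul n).symm y.1 (y.1 * x) 0 y.1).submatrix
      (doubleCosetPerm h hr hs hm) id := by
    rw [hZ, hw, doubleCosetRep, Units.val_mul, permGL_mul, Units.val_mul, hu, diag_val, mat2_mul]
    simp
  -- The last `s` rows of `Z` are `(yᵢ, yᵢ x)` with `yᵢ ∈ im f₁` and `(0, yᵢ)` with `yᵢ ∈ f₂(ker
  -- f₁)`. All are combinations of the last `s` rows of `g`, which is what puts `Z * g⁻¹` in `P`.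
  have rows : ∀ j, ∃ d, (∀ i, f₁ d i = Z.1 (p2 hm j) (p1 (two_mul n).symm i)) ∧
      ∀ i, f₂ d i = Z.1 (p2 hm j) (p2 (two_mul n).symm i) := by
    rw [forall_e3 hs, Zval]
    refine ⟨fun j => ?_, fun j => ?_, fun j => ?_⟩
    · obtain ⟨d, h1, h2⟩ := lift _ (hy₁ j)
      exact ⟨d, by simp [h1], by simp [h2, mul_apply_eq_vecMul]⟩
    · obtain ⟨d, h1, h2⟩ := lift _ (hle (hy₂ j))
      exact ⟨d, by simp [h1], by simp [h2, mul_apply_eq_vecMul]⟩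
    · obtain ⟨d, h1, h2⟩ := hy₂ j
      exact ⟨d, by simpa using congrFun h1, by simp [h2]⟩
  have hp : Z * g⁻¹ ∈ parabolic2 F hm := by
    rw [mem_parabolic2]
    intro j i
    obtain ⟨d, h1, h2⟩ := rows j
    have e : Z.1 (p2 hm j) = (Sum.elim 0 d ∘ (e2 hm).symm) ᵥ* g.1 := by
      funext i
      revert i
      rw [forall_e2 (two_mul n).symm]
      refine ⟨fun i => ?_, fun i => ?_⟩
      · rw [← h1, hf₁]
        simp only [vecMul, dotProduct, ← (e2 hm).sum_comp, Fintype.sum_sum_type]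
        simp [p2]
      · rw [← h2, hf₂]
        simp only [vecMul, dotProduct, ← (e2 hm).sum_comp, Fintype.sum_sum_type]
        simp [p2]
    rw [Units.val_mul, mul_apply_eq_vecMul, e, vecMul_vecMul, ← Units.val_mul, mul_inv_cancel]
    simp [p1]
  refine ⟨⟨_, inv_mem hp⟩, y, u, ?_⟩
  simp only [hZ]
  group

/-- Every element of `GL_{2n}` lies in the double coset of one of the representatives, or in one
that does not support `(N, ψ)`-equivariant functions. -/
theorem exists_doubleCoset_or_unipotent {n r : ℕ} (hr : r ≤ 2 * n) {ψ₀ : AddChar F ℂ}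
    (hψ₀ : ψ₀ ≠ 1) (g : GL (Fin (2 * n)) F) :
    (∃ (k : Index n r) (p : parabolic2 F (Nat.add_sub_of_le hr)) (y : GL (Fin n) F)
      (u : unipN F n), g = p.1 *
        doubleCosetRep k.size_n k.size_r k.size_s (Nat.add_sub_of_le hr) F * diag F n y * u) ∨
    ∃ (u : unipN F n) (p : parabolic2 F (Nat.add_sub_of_le hr)), p.1 * g = g * u.1 ∧
      levi1 _ p = 1 ∧ levi2 _ p = 1 ∧ psi ψ₀ n u ≠ 1 := by
  set hm := Nat.add_sub_of_le hr
  set tn := (two_mul n).symm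
  let B₁ := g.1.submatrix (p2 hm) (p1 tn)
  let B₂ := g.1.submatrix (p2 hm) (p2 tn)
  let f₁ : (Fin (2 * n - r) → F) →ₗ[F] (Fin n → F) := Matrix.toLinearMapRight' B₁
  let f₂ : (Fin (2 * n - r) → F) →ₗ[F] (Fin n → F) := Matrix.toLinearMapRight' B₂
  have hf₁ : ∀ v, f₁ v = v ᵥ* B₁ := fun v => rfl
  have hf₂ : ∀ v, f₂ v = v ᵥ* B₂ := fun v => rfl
  by_cases hle : (LinearMap.ker f₁).map f₂ ≤ LinearMap.range f₁
  · left
    -- The last rows of the invertible `g` are independent, so `f₂` is injective on `ker f₁` and the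
    -- smaller step of the flag has dimension `c = dim ker f₁`.
    have hinj : ∀ v, f₁ v = 0 → f₂ v = 0 → v = 0 := by
      intro v h1 h2
      have e : (Sum.elim 0 v ∘ (e2 hm).symm) ᵥ* g.1 = 0 := by
        funext i
        revert i
        rw [forall_e2 tn]
        refine ⟨fun i => (Eq.trans ?_ (congrFun (hf₁ v) i).symm).trans (congrFun h1 i),
          fun i => (Eq.trans ?_ (congrFun (hf₂ v) i).symm).trans (congrFun h2 i)⟩ <;>
        · simp only [vecMul, dotProduct, ← (e2 hm).sum_comp, Fintype.sum_sum_type]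
          simp [p2, B₁, B₂]
      have e' := congrArg (fun z => z ᵥ* (g⁻¹).1) e
      simp only [vecMul_vecMul, ← Units.val_mul, mul_inv_cancel, zero_vecMul] at e'
      funext i
      simpa [p2] using congrFun e' (p2 hm i)
    have hd : Module.finrank F ((LinearMap.ker f₁).map f₂) = Module.finrank F (LinearMap.ker f₁) := by
      have hi : Function.Injective (f₂ ∘ₗ (LinearMap.ker f₁).subtype) := by
        rw [injective_iff_map_eq_zero]
        exact fun v hv => Subtype.ext (hinj v v.2 hv)
      rw [← LinearMap.finrank_range_of_inj hi, LinearMap.range_comp, Submodule.range_subtype]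
    have h1 := f₁.finrank_range_add_finrank_ker
    have h2 := Submodule.finrank_mono hle
    have h3 := Submodule.finrank_le (LinearMap.range f₁)
    rw [Module.finrank_fin_fun] at h1 h3
    obtain ⟨c, hc⟩ : ∃ c, c = Module.finrank F (LinearMap.ker f₁) := ⟨_, rfl⟩
    -- From `rank f₁ = 2n - r - c ≤ n` comes `n ≤ c + r`, so the subtraction is not truncated; the
    -- inclusion `hle` gives `c ≤ rank f₁`, hence `k ≤ r / 2`.
    obtain ⟨k, hk⟩ : ∃ k : Index n r, k.1 = c + r - n := ⟨⟨c + r - n, by omega, by omega⟩, rfl⟩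
    exact ⟨k, exists_eq_mul_doubleCosetRep hm k.size_n k.size_r k.size_s g hf₁ hf₂ hle
      (by have := k.2; omega) (by have := k.2; omega)⟩
  · right
    obtain ⟨_, ⟨v, hv, rfl⟩, hv'⟩ := SetLike.not_le_iff_exists.1 hle
    obtain ⟨f, hf, hker⟩ := Submodule.exists_le_ker_of_notMem hv'
    obtain ⟨t, ht⟩ := AddChar.ne_one_iff.1 hψ₀
    -- The vector representing the functional `f`, which vanishes on `im f₁`, rescaled to take the
    -- value `1` at `f₂ v`.
    let l : Fin n → F := fun i => (f (f₂ v))⁻¹ * f (Pi.single i 1)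
    have hl : ∀ z, z ⬝ᵥ l = (f (f₂ v))⁻¹ * f z := by
      intro z
      rw [LinearMap.pi_apply_eq_sum_univ f z, Finset.mul_sum]
      refine Finset.sum_congr rfl fun i _ => ?_
      have : (fun j => if i = j then (1 : F) else 0) = Pi.single i 1 := by
        ext j; simp [Pi.single_apply, eq_comm]
      rw [this, smul_eq_mul]
      ring
    obtain ⟨u, p, h1, h2, h3, h4⟩ := exists_unipotent_stabilizer hm g ψ₀ (v := v) (l := l) hv
      (by
        funext i
        change B₁ i ⬝ᵥ l = 0
        rw [hl]
        have : B₁ i = f₁ (Pi.single i 1) := by rw [hf₁, single_one_vecMul]; rfl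
        rw [this, LinearMap.mem_ker.1 (hker ⟨_, rfl⟩), mul_zero])
      ((hl _).trans (inv_mul_cancel₀ hf)) t
    exact ⟨u, p, h1, h2, h3, h4 ▸ ht⟩

end Cover
end TwistedJacquet

/-! ### Verification of the Mackey hypotheses for `P_{r,2n-r}`, `N` and `ΔG_n`. -/

open TwistedJacquet in
theorem mainTheorem3 {F : Type*} [Field F] [Finite F] (n r : ℕ) (hr₁ : 1 ≤ r) (hr₂ : r < 2 * n)
    {V₁ V₂ : Type*} [AddCommGroup V₁] [Module ℂ V₁] [FiniteDimensional ℂ V₁]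
    [AddCommGroup V₂] [Module ℂ V₂] [FiniteDimensional ℂ V₂]
    (ρ₁ : Representation ℂ (Matrix.GeneralLinearGroup (Fin r) F) V₁)
    (ρ₂ : Representation ℂ (Matrix.GeneralLinearGroup (Fin (2 * n - r)) F) V₂)
    (ψ₀ : AddChar F ℂ) (hψ₀ : ψ₀ ≠ 1) :
    Nonempty
      (Representation.Equiv
        (TwistedJacquet.jacquetN ψ₀
          (TwistedJacquet.parInd (Nat.add_sub_of_le hr₂.le) ρ₁ ρ₂))
        (Representation.directSum fun k : TwistedJacquet.Index n r =>
          TwistedJacquet.indTau ψ₀ k.size_n k.size_r k.size_s ρ₁ ρ₂)) := by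
  have (m : ℕ) (U : Subgroup (Matrix.GeneralLinearGroup (Fin m) F)) : Fintype U := Fintype.ofFinite U
  have : Finite (Index n r) := Finite.of_injective
    (fun k => (⟨k.1, by have := k.2; omega⟩ : Fin (r + 1)))
    fun k l e => Subtype.ext (congrArg Fin.val e)
  let hm := Nat.add_sub_of_le hr₂.le
  refine nonempty_equiv_directSum_coind
    (w := fun k : Index n r => doubleCosetRep k.size_n k.size_r k.size_s hm F)
    (q := fun k => TensorProduct.map
      (twistSpan ρ₁ (unip1 F k.size_r) (psi1 ψ₀ k.size_r)).mkQ
      (twistSpan ρ₂ (unip2 F k.size_s) (psi2 ψ₀ k.size_s)).mkQ)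
    (s := fun k => TensorProduct.map
      (twistSec ρ₁ (unip1 F k.size_r) (psi1 ψ₀ k.size_r))
      (twistSec ρ₂ (unip2 F k.size_s) (psi2 ψ₀ k.size_s)))
    (Delta_le_twistNormalizer ψ₀ n) ?_ ?_ ?_ ?_ ?_ ?_
  · rintro k z
    obtain ⟨p, hp, h₁, h₂⟩ := exists_parabolic2_of_parabolic3 k.size_n k.size_r k.size_s hm
      (ofDelta _ z)
    have hz : diag F n (ofDelta _ z).1 = z.1 :=
      congrArg Subtype.val ((ofDelta (parabolic3 F k.size_n)).symm_apply_apply z)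
    refine ⟨p, by rw [hp, hz], ?_, ?_⟩
    · change _ ∘ₗ TensorProduct.map (ρ₁ (levi1 hm p)) (ρ₂ (levi2 hm p)) =
        TensorProduct.map _ _ ∘ₗ _
      rw [← TensorProduct.map_comp, ← TensorProduct.map_comp, h₁, h₂]
      rfl
    · change TensorProduct.map (ρ₁ (levi1 hm p)) (ρ₂ (levi2 hm p)) ∘ₗ _ =
        _ ∘ₗ TensorProduct.map _ _
      rw [← TensorProduct.map_comp, ← TensorProduct.map_comp, h₁, h₂]
      exact congrArg₂ TensorProduct.map
        (twistNormalizer_comp_twistSec ρ₁ _ _ ⟨_, toFirst_mem ψ₀ k.size_n k.size_r _⟩)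
        (twistNormalizer_comp_twistSec ρ₂ _ _ ⟨_, toSecond_mem ψ₀ k.size_n k.size_s _⟩)
  · intro k u p hp
    obtain ⟨h₁, h₂, e⟩ := levi_mem_unip k.size_n k.size_r k.size_s hm ψ₀ u p hp
    change TensorProduct.map (ρ₁ (levi1 hm p)) (ρ₂ (levi2 hm p)) ∘ₗ _ = _
    rw [← TensorProduct.map_comp, comp_twistSec ρ₁ _ _ ⟨_, h₁⟩, comp_twistSec ρ₂ _ _ ⟨_, h₂⟩,
      TensorProduct.map_smul_left, TensorProduct.map_smul_right, smul_smul, e]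
  · rintro k l p ⟨_, y, _, rfl⟩ u hp
    rw [mul_assoc] at hp
    have hrank := rank_lowerLeft_eq hm p _ _ y u hp
    rw [rank_doubleCosetRep_lowerLeft, rank_doubleCosetRep_lowerLeft] at hrank
    -- The rank is `(r - 2k) + (n + k - r) = n - k`, which determines `k`.
    obtain rfl : k = l := Subtype.ext (by have := k.2; have := l.2; omega)
    exact ⟨rfl, _, diag_mem_parabolic3 k.size_n k.size_r k.size_s hm p y u hp, rfl⟩
  · intro k
    rw [← TensorProduct.map_comp, mkQ_comp_twistSec, mkQ_comp_twistSec, TensorProduct.map_id]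
  · intro k v hv
    rw [← LinearMap.comp_apply, ← TensorProduct.map_comp, twistSec_comp_mkQ, twistSec_comp_mkQ]
    -- Each pair `(u₁, u₂)` is the Levi part of some stabilizing `p`, so `v` is equivariant under
    -- both groups and is fixed by the two averages.
    have key : ∀ (u₁ : unip1 F k.size_r) (u₂ : unip2 F k.size_s),
        TensorProduct.map (ρ₁ u₁) (ρ₂ u₂) v =
          (psi1 ψ₀ k.size_r u₁ * psi2 ψ₀ k.size_s u₂) • v := by
      intro u₁ u₂
      obtain ⟨u, p, hp, h₁, h₂⟩ := exists_of_unip k.size_n k.size_r k.size_s hm u₁ u₂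
      obtain ⟨m₁, m₂, e⟩ := levi_mem_unip k.size_n k.size_r k.size_s hm ψ₀ u p hp
      have h := hv u p hp
      change TensorProduct.map (ρ₁ (levi1 hm p)) (ρ₂ (levi2 hm p)) v = _ at h
      rw [e] at h
      simpa only [h₁, h₂] using h
    rw [← LinearMap.rTensor_comp_lTensor, LinearMap.comp_apply,
      lTensor_twistAvg_of_equivariant, rTensor_twistAvg_of_equivariant]
    · intro u
      simpa [LinearMap.rTensor, Module.End.one_eq_id] using key u 1
    · intro u
      simpa [LinearMap.lTensor, Module.End.one_eq_id] using key 1 u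
  · intro g
    rcases exists_doubleCoset_or_unipotent hr₂.le hψ₀ g with ⟨k, p, y, u, e⟩ | ⟨u, p, e, h₁, h₂, h₃⟩
    · exact Or.inl ⟨k, p, ⟨_, y, trivial, rfl⟩, u, e⟩
    -- Both Levi components of `p` are trivial, so `ρ₁ ⊗ ρ₂` inflated to `P` is the identity at `p`.
    · refine Or.inr ⟨u, p, e, ?_, h₃⟩
      change TensorProduct.map (ρ₁ (levi1 hm p)) (ρ₂ (levi2 hm p)) = 1
      rw [h₁, h₂, map_one, map_one, TensorProduct.map_one]
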